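/- Let $M$ and $N$ be smooth $n$-dimensional Riemannian manifolds, and let $\Omega\subset M$, $\Lambda\subset N$ be domains (non-empty connected open sets, not necessarily bounded). Let $c:\Omega\times\Lambda\to\mathbf R$ be a cost function and put $c^*(y,x)=c(x,y)$. Gradients are taken with respect to the Riemannian metrics, and $D^2_{xx}c$ denotes the Riemannian Hessian in $x$, i.e. the matrix of second derivatives in geodesic normal coordinates centered at the point $x$. Assume: (A0) $c\in C^4_{\rm loc}(\overline\Omega\times\overline\Lambda)$, i.e. $c$ is $C^4$ on $\Omega\times\Lambda$ and its derivatives of order at most $4$ extend continuously to $\overline\Omega\times\overline\Lambda$ (derivatives at boundary points below are these extensions); (A1) for every $x\in\Omega$ the map $y\mapsto-\nabla_xc(x,y)$ is injective on $\overline\Lambda$, and for every $y\in\Lambda$ the map $x\mapsto-\nabla_yc(x,y)$ is injective on $\overline\Omega$; (A2) $\det D^2_{xy}c(x,y)\neq0$ for all $x\in\overline\Omega$, $y\in\overline\Lambda$. For $x\in\Omega$ let $\mathrm{dom}(c\text{-Exp}_x)=\{-\nabla_xc(x,y): y\in\Lambda\}\subset T_xM$, and let $c\text{-Exp}_x\,p=y$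 if $y\in\Lambda$ and $p=-\nabla_xc(x,y)$. Assume further that $\Lambda$ is $c$-convex with respect to $\Omega$ (the set $\{-\nabla_xc(x,y): y\in\Lambda\}\subset T_xM$ is convex for every $x\in\Omega$) and that $\Omega$ is $c^*$-convex with respect to $\Lambda$ (the set $\{-\nabla_yc(x,y): x\in\Omega\}\subset T_yN$ is convex for every $y\in\Lambda$). For $(x,y)\in\Omega\times\Lambda$ and $\eta,\xi\in T_xM$ define the $c$-sectional curvature $$\mathfrak S_c(x,y)(\eta,\xi)=\frac{d^2}{dt^2}\Big|_{t=0}\big[-D^2_{xx}c\big]\big(x,\,c\text{-Exp}_x(p+t\xi)\big)\,\eta\,\eta,\qquad p=-\nabla_xc(x,y).$$ We say that $c$ satisfies A3W (resp. A3S) if there is a constant $C_0\ge0$ (resp. $C_0>0$) such that $\mathfrak S_c(x,y)(\eta,\xi)\ge C_0|\eta|^2|\xi|^2$ for all $(x,y)\in\Omega\times\Lambda$ and all $\eta,\xi\in T_xM$ with $\eta\perp\xi$. Given $x_m\in\Omega$ and $y_0,y_1\in\Lambda$, let $p_i=-\nabla_xc(x_m,y_i)$ for $i=0,1$, let $y_\theta=c\text{-Exp}_{x_m}\big((1-\theta)p_0+\theta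 p_1\big)$, which is defined for all $\theta$ in a neighbourhood of $[0,1]$, and for $x\in\Omega$ put $$f_\theta(x)=-c(x,y_\theta)+c(x_m,y_\theta),\qquad S_\theta=\Big\{x\in\Omega:\tfrac{d}{d\theta}f_\theta(x)=0\Big\},\qquad S^+_\theta=\Big\{x\in\Omega:\tfrac{d}{d\theta}f_\theta(x)\ge0\Big\}.$$ 1. If $c$ satisfies A3W, then for all $x_m\in\Omega$ and $y_0,y_1\in\Lambda$, $$S^+_{\theta_1}\subset S^+_{\theta_2}\quad\text{whenever }0\le\theta_1\le\theta_2\le1.$$ 2. If $c$ satisfies A3S, then for all $x_m\in\Omega$ and all $y_0,y_1\in\Lambda$ with $y_0\ne y_1$, the inclusions in 1 hold and moreover $$S_{\theta_1}\cap S_{\theta_2}=\{x_m\}\quad\text{whenever }0\le\theta_1<\theta_2\le1.$$ -/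

import Mathlib

open scoped Manifold ContDiff Topology
open Set Filter

namespace CostTransport

noncomputable section

/-- The model space `ℝⁿ`. -/
abbrev Euc (n : ℕ) : Type := EuclideanSpace ℝ (Fin n)

/-- Smooth Riemannian metrics on an `n`-dimensional manifold without boundary. -/
abbrev RMetric (n : ℕ) (M : Type*) [TopologicalSpace M] [ChartedSpace (Euc n) M]
    [IsManifold (𝓡 n) ∞ M] : Type _ :=
  Bundle.ContMDiffRiemannianMetric (𝓡 n) ∞ (Euc n) (fun x : M => TangentSpace (𝓡 n) x)

section Riemannian

variable {n : ℕ} {M : Type*} [TopologicalSpace M] [ChartedSpace (Euc n) M]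
  [IsManifold (𝓡 n) ∞ M]

/-- The isomorphism `T_x^* M → T_x M` given by the metric: the inverse of `v ↦ ⟨v, ·⟩`. -/
def sharp (g : RMetric n M) (x : M) :
    (TangentSpace (𝓡 n) x →L[ℝ] ℝ) →L[ℝ] TangentSpace (𝓡 n) x :=
  (g.inner x).inverse

theorem inner_isInvertible (g : RMetric n M) (x : M) : (g.inner x).IsInvertible := by
  have hinj : Function.Injective (g.inner x) := by
    rw [injective_iff_map_eq_zero]
    intro v hv
    by_contra hne
    have h := g.pos x v hne
    rw [hv] at h
    exact lt_irrefl _ h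
  let f : Euc n →L[ℝ] (Euc n →L[ℝ] ℝ) := g.inner x
  let A : Euc n →ₗ[ℝ] (Euc n →L[ℝ] ℝ) := f.toLinearMap
  have hrank : Module.finrank ℝ (Euc n) = Module.finrank ℝ (Euc n →L[ℝ] ℝ) := by
    rw [← (LinearMap.toContinuousLinearMap (𝕜 := ℝ) (E := Euc n) (F' := ℝ)).finrank_eq]
    exact Subspace.dual_finrank_eq.symm
  let e := LinearEquiv.ofInjectiveOfFinrankEq A hinj hrank
  exact ⟨e.toContinuousLinearEquiv, rfl⟩

theorem inner_sharp (g : RMetric n M) (x : M) (α : TangentSpace (𝓡 n) x →L[ℝ] ℝ)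
    (w : TangentSpace (𝓡 n) x) : g.inner x (sharp g x α) w = α w := by
  obtain ⟨e, he⟩ := inner_isInvertible g x
  have : g.inner x (sharp g x α) = α := by
    unfold sharp
    rw [← he, ContinuousLinearMap.inverse_equiv]
    exact e.apply_symm_apply α
  rw [this]

/-- The Riemannian gradient of `f` at `x`: `⟨∇f(x), w⟩ = df_x(w)` for all `w ∈ T_x M`. -/
def grad (g : RMetric n M) (f : M → ℝ) (x : M) : TangentSpace (𝓡 n) x :=
  sharp g x (mfderiv (𝓡 n) 𝓘(ℝ, ℝ) f x)

theorem inner_grad (g : RMetric n M) (f : M → ℝ) (x : M) (w : TangentSpace (𝓡 n) x) :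
    g.inner x (grad g f x) w = mfderiv (𝓡 n) 𝓘(ℝ, ℝ) f x w :=
  inner_sharp g x _ w

/-- The metric in the coordinates of the preferred chart at `x`: the bilinear form
`(g_ij(z))` at the coordinate point `z`. -/
def metricInChart (g : RMetric n M) (x : M) (z : Euc n) : Euc n →L[ℝ] Euc n →L[ℝ] ℝ :=
  let φ := extChartAt (𝓡 n) x
  let A : Euc n →L[ℝ] Euc n := mfderiv 𝓘(ℝ, Euc n) (𝓡 n) φ.symm z
  let G : Euc n →L[ℝ] Euc n →L[ℝ] ℝ := g.inner (φ.symm z)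
  G.bilinearComp A A

/-- The Christoffel symbols of the Levi-Civita connection at `x`, in the preferred chart at `x`:
`⟨Γ(u,v), w⟩ = (∂_u g(v,w) + ∂_v g(u,w) - ∂_w g(u,v)) / 2`. The coordinate basis of this chart
at `x` is the standard basis of `T_x M`. -/
def christoffel (g : RMetric n M) (x : M) (u v : TangentSpace (𝓡 n) x) : TangentSpace (𝓡 n) x :=
  let D : Euc n →L[ℝ] Euc n →L[ℝ] Euc n →L[ℝ] ℝ :=
    fderiv ℝ (metricInChart g x) (extChartAt (𝓡 n) x x)
  let u' : Euc n := u
  let v' : Euc n := v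
  sharp g x ((1 / 2 : ℝ) • (D u' v' + D v' u' - (D.flip u').flip v'))

/-- The Riemannian Hessian of `f` at `x`, `D²f(u,v) = ∂_u∂_v f - df(Γ(u,v))`, that is, the second
derivative of `f` in geodesic normal coordinates centered at `x`. -/
def hess (g : RMetric n M) (f : M → ℝ) (x : M) (u v : TangentSpace (𝓡 n) x) : ℝ :=
  let φ := extChartAt (𝓡 n) x
  let df : TangentSpace (𝓡 n) x →L[ℝ] ℝ := mfderiv (𝓡 n) 𝓘(ℝ, ℝ) f x
  fderiv ℝ (fderiv ℝ (f ∘ φ.symm)) (φ x) u v - df (christoffel g x u v)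

end Riemannian

section Cost

variable {n : ℕ}
  {M : Type*} [TopologicalSpace M] [ChartedSpace (Euc n) M] [IsManifold (𝓡 n) ∞ M]
  {N : Type*} [TopologicalSpace N] [ChartedSpace (Euc n) N] [IsManifold (𝓡 n) ∞ N]

/-- `c` in the coordinates of the preferred charts at `x₀` and `y₀`. -/
def costInChart (c : M → N → ℝ) (x₀ : M) (y₀ : N) (z : Euc n × Euc n) : ℝ :=
  c ((extChartAt (𝓡 n) x₀).symm z.1) ((extChartAt (𝓡 n) y₀).symm z.2)

/-- (A0): `c ∈ C⁴_loc(closure Ω × closure Λ)`. The cost is `C⁴` on `Ω × Λ`, and all its partial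
derivatives of order at most `4` in charts extend continuously to `closure Ω × closure Λ`
(they have a limit at each of its points). Only the values of `c` on `Ω × Λ` matter. -/
def A0 (n : ℕ) {M : Type*} [TopologicalSpace M] [ChartedSpace (Euc n) M]
    {N : Type*} [TopologicalSpace N] [ChartedSpace (Euc n) N]
    (c : M → N → ℝ) (Ω : Set M) (Λ : Set N) : Prop :=
  ContMDiffOn ((𝓡 n).prod (𝓡 n)) 𝓘(ℝ, ℝ) 4 (fun p : M × N => c p.1 p.2) (Ω ×ˢ Λ) ∧
  ∀ x₀ ∈ closure Ω, ∀ y₀ ∈ closure Λ, ∀ k : ℕ, k ≤ 4 →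
    ∃ L, Tendsto
      (fun p : M × N => iteratedFDeriv ℝ k (costInChart c x₀ y₀)
        (extChartAt (𝓡 n) x₀ p.1, extChartAt (𝓡 n) y₀ p.2))
      (𝓝[Ω ×ˢ Λ] (x₀, y₀)) (𝓝 L)

/-- The covector `-∇_x c(x, y)`, as a tangent vector at `x`. For the cost `c^*(y,x) = c(x,y)`,
that is for `fun y x => c x y`, this is `-∇_y c(x, y)`. -/
def momentum (g : RMetric n M) (c : M → N → ℝ) (x : M) (y : N) : TangentSpace (𝓡 n) x :=
  -grad g (fun x' => c x' y) x

/-- One half of (A1): for each `x ∈ Ω`, the map `y ↦ -∇_x c(x, y)`, extended from `Λ` to `closure Λ`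
by continuity, is injective on `closure Λ`. -/
def Twist (g : RMetric n M) (c : M → N → ℝ) (Ω : Set M) (Λ : Set N) : Prop :=
  ∀ x ∈ Ω, InjOn (extendFrom Λ (momentum g c x)) (closure Λ)

/-- (A1). -/
def A1 (g : RMetric n M) (h : RMetric n N) (c : M → N → ℝ) (Ω : Set M) (Λ : Set N) : Prop :=
  Twist g c Ω Λ ∧ Twist h (fun y x => c x y) Λ Ω

/-- The matrix `∂²c / ∂xᵢ∂yⱼ` at `p = (x, y)`, in the charts around `x₀` and `y₀`. -/
def mixedHess (n : ℕ) {M : Type*} [TopologicalSpace M] [ChartedSpace (Euc n) M]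
    {N : Type*} [TopologicalSpace N] [ChartedSpace (Euc n) N] (c : M → N → ℝ) (x₀ : M) (y₀ : N) (p : M × N) :
    Matrix (Fin n) (Fin n) ℝ :=
  Matrix.of fun i j =>
    fderiv ℝ (fderiv ℝ (costInChart c x₀ y₀))
      (extChartAt (𝓡 n) x₀ p.1, extChartAt (𝓡 n) y₀ p.2)
      (0, EuclideanSpace.single j (1 : ℝ)) (EuclideanSpace.single i (1 : ℝ), 0)

/-- (A2): `det D²_{xy} c ≠ 0` on `closure Ω × closure Λ`, the second derivatives being extended from
`Ω × Λ` by continuity. (Whether the determinant vanishes does not depend on the charts.) -/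
def A2 (n : ℕ) {M : Type*} [TopologicalSpace M] [ChartedSpace (Euc n) M]
    {N : Type*} [TopologicalSpace N] [ChartedSpace (Euc n) N]
    (c : M → N → ℝ) (Ω : Set M) (Λ : Set N) : Prop :=
  ∀ x ∈ closure Ω, ∀ y ∈ closure Λ,
    (extendFrom (Ω ×ˢ Λ) (mixedHess n c x y) (x, y)).det ≠ 0

/-- `dom(c-Exp_x) = (c-Exp_x)⁻¹ Λ`, the set of all `-∇_x c(x, y)` with `y ∈ Λ`. -/
def domCExp (g : RMetric n M) (c : M → N → ℝ) (Λ : Set N) (x : M) : Set (TangentSpace (𝓡 n) x) :=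
  momentum g c x '' Λ

/-- The `c`-exponential map: `c-Exp_x p = y` if `y ∈ Λ` and `p = -∇_x c(x, y)`
(with an unspecified value for `p` outside `domCExp`). -/
def cExp [Nonempty N] (g : RMetric n M) (c : M → N → ℝ) (Λ : Set N) (x : M)
    (p : TangentSpace (𝓡 n) x) : N :=
  Function.invFunOn (momentum g c x) Λ p

/-- `Λ` is `c`-convex with respect to `Ω`. The `c^*`-convexity of `Ω` with respect to `Λ` is
this notion for the cost `fun y x => c x y`. -/
def CConvex (g : RMetric n M) (c : M → N → ℝ) (Ω : Set M) (Λ : Set N) : Prop :=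
  ∀ x ∈ Ω, Convex ℝ (domCExp g c Λ x)

/-- The `c`-sectional curvature
`𝔖_c(x,y)(η,ξ) = d²/dt²|_{t=0} [-D²_{xx} c](x, c-Exp_x(p + tξ)) η η`, `p = -∇_x c(x,y)`. -/
def cSectionalCurvature [Nonempty N] (g : RMetric n M) (c : M → N → ℝ) (Λ : Set N)
    (x : M) (y : N) (η ξ : TangentSpace (𝓡 n) x) : ℝ :=
  iteratedDeriv 2
    (fun t : ℝ => -hess g (fun x' => c x' (cExp g c Λ x (momentum g c x y + t • ξ))) x η η) 0

/-- `𝔖_c(x,y)(η,ξ) ≥ C₀ |η|² |ξ|²` for all `(x,y) ∈ Ω × Λ` and all `η ⟂ ξ` in `T_x M`. -/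
def CurvatureBound [Nonempty N] (g : RMetric n M) (c : M → N → ℝ) (Ω : Set M) (Λ : Set N)
    (C₀ : ℝ) : Prop :=
  ∀ x ∈ Ω, ∀ y ∈ Λ, ∀ η ξ : TangentSpace (𝓡 n) x, g.inner x η ξ = 0 →
    C₀ * g.inner x η η * g.inner x ξ ξ ≤ cSectionalCurvature g c Λ x y η ξ

/-- (A3W). -/
def A3W [Nonempty N] (g : RMetric n M) (c : M → N → ℝ) (Ω : Set M) (Λ : Set N) : Prop :=
  ∃ C₀ : ℝ, 0 ≤ C₀ ∧ CurvatureBound g c Ω Λ C₀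

/-- (A3S). -/
def A3S [Nonempty N] (g : RMetric n M) (c : M → N → ℝ) (Ω : Set M) (Λ : Set N) : Prop :=
  ∃ C₀ : ℝ, 0 < C₀ ∧ CurvatureBound g c Ω Λ C₀

/-- `y_θ = c-Exp_{x_m}((1-θ) p₀ + θ p₁)` with `p_i = -∇_x c(x_m, y_i)`; for `θ ∈ [0,1]` this is
the `c`-segment from `y₀` to `y₁` with respect to `x_m`. -/
def cSegment [Nonempty N] (g : RMetric n M) (c : M → N → ℝ) (Λ : Set N) (xm : M) (y₀ y₁ : N)
    (θ : ℝ) : N :=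
  cExp g c Λ xm ((1 - θ) • momentum g c xm y₀ + θ • momentum g c xm y₁)

/-- The sliding mountain `f_θ(x) = -c(x, y_θ) + c(x_m, y_θ)`. -/
def slidingMountain [Nonempty N] (g : RMetric n M) (c : M → N → ℝ) (Λ : Set N) (xm : M)
    (y₀ y₁ : N) (θ : ℝ) (x : M) : ℝ :=
  -c x (cSegment g c Λ xm y₀ y₁ θ) + c xm (cSegment g c Λ xm y₀ y₁ θ)

/-- The level set `S_θ = {x ∈ Ω | (d/dθ) f_θ(x) = 0}`. -/
def levelSet [Nonempty N] (g : RMetric n M) (c : M → N → ℝ) (Ω : Set M) (Λ : Set N) (xm : M)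
    (y₀ y₁ : N) (θ : ℝ) : Set M :=
  {x ∈ Ω | deriv (fun s => slidingMountain g c Λ xm y₀ y₁ s x) θ = 0}

/-- The super-level set `S⁺_θ = {x ∈ Ω | (d/dθ) f_θ(x) ≥ 0}`. -/
def superLevelSet [Nonempty N] (g : RMetric n M) (c : M → N → ℝ) (Ω : Set M) (Λ : Set N) (xm : M)
    (y₀ y₁ : N) (θ : ℝ) : Set M :=
  {x ∈ Ω | 0 ≤ deriv (fun s => slidingMountain g c Λ xm y₀ y₁ s x) θ}

/-- (Monotonicity): `S⁺_{θ₁} ⊆ S⁺_{θ₂}` for `0 ≤ θ₁ ≤ θ₂ ≤ 1`. -/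
def Monotonicity [Nonempty N] (g : RMetric n M) (c : M → N → ℝ) (Ω : Set M) (Λ : Set N) (xm : M)
    (y₀ y₁ : N) : Prop :=
  ∀ θ₁ θ₂ : ℝ, 0 ≤ θ₁ → θ₁ ≤ θ₂ → θ₂ ≤ 1 →
    superLevelSet g c Ω Λ xm y₀ y₁ θ₁ ⊆ superLevelSet g c Ω Λ xm y₀ y₁ θ₂

/-- (Strict Monotonicity): monotonicity, and `S_{θ₁} ∩ S_{θ₂} = {x_m}` for `0 ≤ θ₁ < θ₂ ≤ 1`. -/
def StrictMonotonicity [Nonempty N] (g : RMetric n M) (c : M → N → ℝ) (Ω : Set M) (Λ : Set N)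
    (xm : M) (y₀ y₁ : N) : Prop :=
  Monotonicity g c Ω Λ xm y₀ y₁ ∧
  ∀ θ₁ θ₂ : ℝ, 0 ≤ θ₁ → θ₁ < θ₂ → θ₂ ≤ 1 →
    levelSet g c Ω Λ xm y₀ y₁ θ₁ ∩ levelSet g c Ω Λ xm y₀ y₁ θ₂ = {xm}

end Cost

end

end CostTransport

/-!
Fix `x_m` and the `c`-segment `y_θ`, and suppose that `d/dθ f_θ(x) = 0` at some `θ`. Join `x_m` to
`x` by the `c^*`-segment `s ↦ x_s` with respect to `y_θ`, and consider
`E(s) = d²/dθ² c(x_s, y_θ)`. As `∂_x c(x_m, y_θ)` is affine in `θ`, `E'(0) = 0`. In `E''(s)` the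
accelerations of the two curves drop out, because `∂_y c` is affine along `x_s` and `∂_x c` is
affine along the `c`-segment with respect to `x_s` which has the same velocity as `y_θ`; what is
left is `-𝔖_c(x_s, y_θ)(η, ξ)`, where `η` is the velocity of `x_s` and `ξ` is dual to the
velocity of `y_θ`. The assumption on `x` says that `η ⟂ ξ`. Taylor's formula now gives
`d²/dθ² f_θ(x) = 𝔖_c(x_s, y_θ)(η, ξ) / 2` for some `s`, so that zeros of `d/dθ f_θ(x)` are crossed
upwards. If the curvature is only nonnegative, crossings may be degenerate, and `x` is first moved
at a small speed in a direction in which `d/dθ f_θ` increases.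
-/

namespace CostTransport

noncomputable section

section DirectionalDerivative

variable {V W G : Type*} [NormedAddCommGroup V] [NormedSpace ℝ V] [NormedAddCommGroup W]
  [NormedSpace ℝ W] [NormedAddCommGroup G] [NormedSpace ℝ G] {f f₁ f₂ : V → G} {p : V}

/-- The derivative of `f` in the constant direction `a`, as an operator on functions, so that it
can be iterated. -/
def dirDeriv (a : V) (f : V → G) (p : V) : G := fderiv ℝ f p a

/-- The second derivative at `p` of `f` along any curve through `p` with velocity `a` and
acceleration `a'`. -/
def jetDeriv (a a' : V) (f : V → G) (p : V) : G :=
  dirDeriv a (dirDeriv a f) p + dirDeriv a' f p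

theorem dirDeriv_zero (f : V → G) (p : V) : dirDeriv 0 f p = 0 := map_zero (fderiv ℝ f p)

theorem jetDeriv_zero_right (a : V) (f : V → G) (p : V) :
    jetDeriv a 0 f p = dirDeriv a (dirDeriv a f) p := by
  rw [jetDeriv, dirDeriv_zero, add_zero]

theorem contDiffAt_dirDeriv {m k : WithTop ℕ∞} (hf : ContDiffAt ℝ k f p) (hk : m + 1 ≤ k) (a : V) :
    ContDiffAt ℝ m (dirDeriv a f) p :=
  (hf.fderiv_right hk).clm_apply contDiffAt_const

theorem contDiffAt_jetDeriv {m k : WithTop ℕ∞} (hf : ContDiffAt ℝ k f p) (hk : m + 2 ≤ k)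
    (a a' : V) : ContDiffAt ℝ m (jetDeriv a a' f) p := by
  have h₂ : m + 1 + 1 ≤ k := by rwa [add_assoc, one_add_one_eq_two]
  exact (contDiffAt_dirDeriv (contDiffAt_dirDeriv hf h₂ a) le_rfl a).add
    (contDiffAt_dirDeriv hf (le_self_add.trans h₂) a')

theorem differentiableAt_dirDeriv (hf : ContDiffAt ℝ 2 f p) (a : V) :
    DifferentiableAt ℝ (dirDeriv a f) p :=
  (contDiffAt_dirDeriv (m := 1) hf le_rfl a).differentiableAt one_ne_zero

theorem dirDeriv_congr (h : f₁ =ᶠ[𝓝 p] f₂) (a : V) : dirDeriv a f₁ =ᶠ[𝓝 p] dirDeriv a f₂ := by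
  filter_upwards [h.eventuallyEq_nhds] with q hq
  simp only [dirDeriv, hq.fderiv_eq]

theorem dirDeriv_dirDeriv (hf : ContDiffAt ℝ 2 f p) (a b : V) :
    dirDeriv a (dirDeriv b f) p = fderiv ℝ (fderiv ℝ f) p a b := by
  have h : DifferentiableAt ℝ (fderiv ℝ f) p :=
    (hf.fderiv_right (m := 1) le_rfl).differentiableAt one_ne_zero
  change fderiv ℝ (fun q => fderiv ℝ f q b) p a = _
  rw [fderiv_clm_apply h (differentiableAt_const b)]
  simp

theorem dirDeriv_comm (hf : ContDiffAt ℝ 2 f p) (a b : V) :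
    dirDeriv a (dirDeriv b f) p = dirDeriv b (dirDeriv a f) p := by
  rw [dirDeriv_dirDeriv hf, dirDeriv_dirDeriv hf]
  exact (hf.isSymmSndFDerivAt (by simp)).eq a b

theorem eventually_dirDeriv_comm (hf : ContDiffAt ℝ 2 f p) (a b : V) :
    dirDeriv a (dirDeriv b f) =ᶠ[𝓝 p] dirDeriv b (dirDeriv a f) := by
  filter_upwards [hf.eventually (by simp)] with q hq using dirDeriv_comm hq a b

theorem dirDeriv_add (hf₁ : DifferentiableAt ℝ f₁ p) (hf₂ : DifferentiableAt ℝ f₂ p) (a : V) :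
    dirDeriv a (f₁ + f₂) p = dirDeriv a f₁ p + dirDeriv a f₂ p := by
  simp only [dirDeriv, fderiv_add hf₁ hf₂, add_apply]

theorem jetDeriv_add (hf₁ : ContDiffAt ℝ 2 f₁ p) (hf₂ : ContDiffAt ℝ 2 f₂ p) (a a' : V) :
    jetDeriv a a' (f₁ + f₂) p = jetDeriv a a' f₁ p + jetDeriv a a' f₂ p := by
  have h : dirDeriv a (f₁ + f₂) =ᶠ[𝓝 p] dirDeriv a f₁ + dirDeriv a f₂ := by
    filter_upwards [hf₁.eventually (by simp), hf₂.eventually (by simp)] with q h₁ h₂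
    exact dirDeriv_add (h₁.differentiableAt two_ne_zero) (h₂.differentiableAt two_ne_zero) a
  rw [jetDeriv, (dirDeriv_congr h a).eq_of_nhds,
    dirDeriv_add (differentiableAt_dirDeriv hf₁ a) (differentiableAt_dirDeriv hf₂ a),
    dirDeriv_add (hf₁.differentiableAt two_ne_zero) (hf₂.differentiableAt two_ne_zero)]
  exact add_add_add_comm _ _ _ _

theorem jetDeriv_dirDeriv_comm (hf : ContDiffAt ℝ 3 f p) (a a' b : V) :
    jetDeriv a a' (dirDeriv b f) p = dirDeriv b (jetDeriv a a' f) p := by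
  have hf₂ : ContDiffAt ℝ 2 f p := hf.of_le (by norm_num)
  have ha : ContDiffAt ℝ 2 (dirDeriv a f) p := contDiffAt_dirDeriv hf (by norm_num) a
  calc jetDeriv a a' (dirDeriv b f) p
      = dirDeriv b (dirDeriv a (dirDeriv a f)) p + dirDeriv b (dirDeriv a' f) p := by
        rw [jetDeriv, (dirDeriv_congr (eventually_dirDeriv_comm hf₂ a b) a).eq_of_nhds,
          dirDeriv_comm ha, dirDeriv_comm hf₂]
    _ = dirDeriv b (jetDeriv a a' f) p :=
        (dirDeriv_add (differentiableAt_dirDeriv ha a) (differentiableAt_dirDeriv hf₂ a') b).symm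

theorem jetDeriv_jetDeriv (hf : ContDiffAt ℝ 4 f p) (a a' b b' : V) :
    jetDeriv a a' (jetDeriv b b' f) p
      = jetDeriv a a' (dirDeriv b (dirDeriv b f)) p + jetDeriv a a' (dirDeriv b' f) p :=
  jetDeriv_add
    (contDiffAt_dirDeriv (contDiffAt_dirDeriv (m := 3) hf (by norm_num) b) (by norm_num) b)
    (contDiffAt_dirDeriv hf (by norm_num) b') a a'

theorem jetDeriv_comm (hf : ContDiffAt ℝ 4 f p) (a a' b b' : V) :
    jetDeriv a a' (jetDeriv b b' f) p = jetDeriv b b' (jetDeriv a a' f) p := by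
  have hf₃ : ContDiffAt ℝ 3 f p := hf.of_le (by norm_num)
  have hb : ContDiffAt ℝ 3 (dirDeriv b f) p := contDiffAt_dirDeriv hf (by norm_num) b
  have h : jetDeriv a a' (dirDeriv b f) =ᶠ[𝓝 p] dirDeriv b (jetDeriv a a' f) := by
    filter_upwards [hf₃.eventually (by simp)] with q hq using jetDeriv_dirDeriv_comm hq a a' b
  rw [jetDeriv_jetDeriv hf, jetDeriv_dirDeriv_comm hb, jetDeriv_dirDeriv_comm hf₃,
    (dirDeriv_congr h b).eq_of_nhds, jetDeriv]

theorem jetDeriv_jetDeriv_eq (hf : ContDiffAt ℝ 4 f p) {a a' b b' b'' : V}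
    (hb' : jetDeriv a a' (dirDeriv b' f) p = 0) (hb'' : jetDeriv a a' (dirDeriv b'' f) p = 0)
    (ha' : jetDeriv b b'' (dirDeriv a' f) p = 0) :
    jetDeriv a a' (jetDeriv b b' f) p = jetDeriv b b'' (dirDeriv a (dirDeriv a f)) p :=
  calc jetDeriv a a' (jetDeriv b b' f) p
      = jetDeriv a a' (jetDeriv b b'' f) p := by
        rw [jetDeriv_jetDeriv hf, jetDeriv_jetDeriv hf, hb', hb'']
    _ = jetDeriv b b'' (jetDeriv a a' f) p := jetDeriv_comm hf a a' b b''
    _ = jetDeriv b b'' (dirDeriv a (dirDeriv a f)) p := by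
        rw [jetDeriv_jetDeriv hf, ha', add_zero]

theorem dirDeriv_comp_equiv (e : W ≃L[ℝ] V) (f : V → G) (a : W) :
    dirDeriv a (f ∘ e) = dirDeriv (e a) f ∘ e := by
  funext p
  simp only [dirDeriv, e.comp_right_fderiv]
  rfl

theorem jetDeriv_comp_equiv (e : W ≃L[ℝ] V) (f : V → G) (a a' : W) :
    jetDeriv a a' (f ∘ e) = jetDeriv (e a) (e a') f ∘ e := by
  funext p
  simp only [jetDeriv, dirDeriv_comp_equiv, Function.comp]

theorem dirDeriv_comp {ι : W → V} {L : W →L[ℝ] V} {q : W} (hι : HasFDerivAt ι L q)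
    (hf : DifferentiableAt ℝ f (ι q)) (a : W) :
    dirDeriv a (fun q => f (ι q)) q = dirDeriv (L a) f (ι q) :=
  congrArg (· a) (hf.hasFDerivAt.comp q hι).fderiv

theorem dirDeriv_dirDeriv_comp {ι : W → V} {L : W →L[ℝ] V} (hι : ∀ q, HasFDerivAt ι L q) {q : W}
    (hf : ContDiffAt ℝ 2 f (ι q)) (a b : W) :
    dirDeriv a (dirDeriv b fun q => f (ι q)) q = dirDeriv (L a) (dirDeriv (L b) f) (ι q) := by
  have h : dirDeriv b (fun q => f (ι q)) =ᶠ[𝓝 q] fun q => dirDeriv (L b) f (ι q) := by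
    filter_upwards [(hι q).continuousAt.eventually (hf.eventually (by simp))] with r hr
    exact dirDeriv_comp (hι _) (hr.differentiableAt two_ne_zero) b
  rw [(dirDeriv_congr h a).eq_of_nhds, dirDeriv_comp (hι _) (differentiableAt_dirDeriv hf (L b))]

theorem jetDeriv_comp {ι : W → V} {L : W →L[ℝ] V} (hι : ∀ q, HasFDerivAt ι L q) {q : W}
    (hf : ContDiffAt ℝ 2 f (ι q)) (a a' : W) :
    jetDeriv a a' (fun q => f (ι q)) q = jetDeriv (L a) (L a') f (ι q) := by
  rw [jetDeriv, dirDeriv_dirDeriv_comp hι hf,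
    dirDeriv_comp (hι _) (hf.differentiableAt two_ne_zero), jetDeriv]

theorem deriv_comp_curve {γ : ℝ → V} {s : ℝ} (hf : DifferentiableAt ℝ f (γ s))
    (hγ : DifferentiableAt ℝ γ s) :
    deriv (fun r => f (γ r)) s = dirDeriv (deriv γ s) f (γ s) :=
  (hf.hasFDerivAt.comp_hasDerivAt s hγ.hasDerivAt).deriv

theorem contDiffAt_deriv {γ : ℝ → V} {s : ℝ} {m k : WithTop ℕ∞} (hγ : ContDiffAt ℝ k γ s)
    (hk : m + 1 ≤ k) : ContDiffAt ℝ m (deriv γ) s :=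
  (hγ.fderiv_right hk).clm_apply (contDiffAt_const (c := (1 : ℝ)))

theorem differentiableAt_deriv {γ : ℝ → V} {s : ℝ} (hγ : ContDiffAt ℝ 2 γ s) :
    DifferentiableAt ℝ (deriv γ) s :=
  (contDiffAt_deriv (m := 1) hγ le_rfl).differentiableAt one_ne_zero

theorem deriv_deriv_comp_curve {γ : ℝ → V} {s : ℝ} (hf : ContDiffAt ℝ 2 f (γ s))
    (hγ : ContDiffAt ℝ 2 γ s) :
    deriv (deriv fun r => f (γ r)) s = jetDeriv (deriv γ s) (deriv (deriv γ) s) f (γ s) := by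
  have h : deriv (fun r => f (γ r)) =ᶠ[𝓝 s] fun r => (fderiv ℝ f ∘ γ) r (deriv γ r) := by
    filter_upwards [hγ.continuousAt.eventually (hf.eventually (by simp)),
      hγ.eventually (by simp)] with r hfr hγr
    exact deriv_comp_curve (hfr.differentiableAt two_ne_zero) (hγr.differentiableAt two_ne_zero)
  have hdf : DifferentiableAt ℝ (fderiv ℝ f) (γ s) :=
    (hf.fderiv_right (m := 1) le_rfl).differentiableAt one_ne_zero
  rw [h.deriv_eq, ((hdf.hasFDerivAt.comp_hasDerivAt s
    (hγ.differentiableAt two_ne_zero).hasDerivAt).clm_apply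
      (differentiableAt_deriv hγ).hasDerivAt).deriv, jetDeriv, dirDeriv_dirDeriv hf]
  rfl

section Prod

variable {f : V × W → G} {z : V} {w : W} {s : ℝ}

theorem deriv_comp_prodMk_right {γ : ℝ → W} (hf : DifferentiableAt ℝ f (z, γ s))
    (hγ : DifferentiableAt ℝ γ s) :
    deriv (fun r => f (z, γ r)) s = dirDeriv (0, deriv γ s) f (z, γ s) :=
  (deriv_comp_curve (f := fun q => f (z, q))
    (hf.comp (γ s) (hasFDerivAt_prodMk_right z _).differentiableAt) hγ).trans
    (dirDeriv_comp (hasFDerivAt_prodMk_right z _) hf _)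

theorem deriv_comp_prodMk_left {γ : ℝ → V} (hf : DifferentiableAt ℝ f (γ s, w))
    (hγ : DifferentiableAt ℝ γ s) :
    deriv (fun r => f (γ r, w)) s = dirDeriv (deriv γ s, 0) f (γ s, w) :=
  (deriv_comp_curve (f := fun q => f (q, w))
    (DifferentiableAt.comp (f := (·, w)) (γ s) hf (by fun_prop)) hγ).trans
    (dirDeriv_comp (ι := (·, w)) (hasFDerivAt_prodMk_left _ w) hf _)

theorem deriv_deriv_comp_prodMk_right {γ : ℝ → W} (hf : ContDiffAt ℝ 2 f (z, γ s))
    (hγ : ContDiffAt ℝ 2 γ s) :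
    deriv (deriv fun r => f (z, γ r)) s
      = jetDeriv (0, deriv γ s) (0, deriv (deriv γ) s) f (z, γ s) :=
  (deriv_deriv_comp_curve (f := fun q => f (z, q)) (hf.comp _ (by fun_prop)) hγ).trans
    (jetDeriv_comp (hasFDerivAt_prodMk_right z) hf _ _)

theorem deriv_deriv_comp_prodMk_left {γ : ℝ → V} (hf : ContDiffAt ℝ 2 f (γ s, w))
    (hγ : ContDiffAt ℝ 2 γ s) :
    deriv (deriv fun r => f (γ r, w)) s
      = jetDeriv (deriv γ s, 0) (deriv (deriv γ) s, 0) f (γ s, w) :=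
  (deriv_deriv_comp_curve (f := fun q => f (q, w))
    (ContDiffAt.comp (f := (·, w)) (γ s) hf (by fun_prop)) hγ).trans
    (jetDeriv_comp (ι := (·, w)) (hasFDerivAt_prodMk_left · w) hf _ _)

end Prod

theorem exists_contDiffAt_rightInverse [FiniteDimensional ℝ V] {m : WithTop ℕ∞} {F : V → V}
    {w₀ : V} (hF : ContDiffAt ℝ m F w₀) (hm : m ≠ 0)
    (hinj : Function.Injective (fderiv ℝ F w₀)) :
    ∃ σ : V → V, ContDiffAt ℝ m σ (F w₀) ∧ σ (F w₀) = w₀ ∧ ∀ᶠ q in 𝓝 (F w₀), F (σ q) = q := by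
  have : CompleteSpace V := FiniteDimensional.complete ℝ V
  let e : V ≃L[ℝ] V :=
    (LinearEquiv.ofInjectiveEndo (fderiv ℝ F w₀).toLinearMap hinj).toContinuousLinearEquiv
  have hF' : HasFDerivAt F (e : V →L[ℝ] V) w₀ := (hF.differentiableAt hm).hasFDerivAt
  exact ⟨hF.localInverse hF' hm, hF.to_localInverse hF' hm, hF.localInverse_apply_image hF' hm,
    (hF.hasStrictFDerivAt' hF' hm).eventually_right_inverse⟩

end DirectionalDerivative

section RealFunctions

theorem exists_second_order_mean_value {E : ℝ → ℝ} (hE : ∀ s ∈ Icc (0 : ℝ) 1, ContDiffAt ℝ 2 E s)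
    (h₀ : deriv E 0 = 0) : ∃ s ∈ Ioo (0 : ℝ) 1, E 1 = E 0 + deriv (deriv E) s / 2 := by
  have hEon : ContDiffOn ℝ ((1 : ℕ) + 1) E (uIcc 0 1) := by
    rw [uIcc_of_le zero_le_one]
    exact fun s hs => ((hE s hs).of_le (by norm_num)).contDiffWithinAt
  have hE₀ : derivWithin E (Icc 0 1) 0 = 0 := by
    rw [((hE 0 (by simp)).differentiableAt two_ne_zero).derivWithin
      (uniqueDiffOn_Icc zero_lt_one 0 (by simp)), h₀]
  obtain ⟨s, hs, hEs⟩ := taylor_mean_remainder_lagrange_iteratedDeriv zero_ne_one hEon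
  rw [uIoo_of_le zero_le_one] at hs
  refine ⟨s, hs, ?_⟩
  rw [uIcc_of_le zero_le_one, taylorWithinEval_succ, taylor_within_zero_eval,
    iteratedDerivWithin_one, hE₀, smul_zero, add_zero, iteratedDeriv_succ, iteratedDeriv_one] at hEs
  norm_num at hEs
  linarith

theorem nonneg_of_right_of_zeros {k : ℝ → ℝ} {a b : ℝ} (hk : ContinuousOn k (Icc a b))
    (ha : 0 ≤ k a) (h₀ : ∀ θ ∈ Ico a b, k θ = 0 → ∀ᶠ t in 𝓝[>] θ, 0 ≤ k t) :
    ∀ θ ∈ Icc a b, 0 ≤ k θ := by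
  have hcl : IsClosed ({θ | 0 ≤ k θ} ∩ Icc a b) := by
    rw [inter_comm]
    exact hk.preimage_isClosed_of_isClosed isClosed_Icc isClosed_Ici
  refine hcl.Icc_subset_of_forall_mem_nhdsWithin ha fun θ hθ => ?_
  rcases (show 0 ≤ k θ from hθ.1).eq_or_lt with hzero | hpos
  · exact h₀ θ hθ.2 hzero.symm
  · have hθ_right : Icc a b ∈ 𝓝[>] θ :=
      mem_of_superset (Ioo_mem_nhdsGT hθ.2.2) fun t ht => ⟨hθ.2.1.trans ht.1.le, ht.2.le⟩
    have hcont : Tendsto k (𝓝[>] θ) (𝓝 (k θ)) :=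
      (hk θ (Ico_subset_Icc_self hθ.2)).mono_left (nhdsWithin_le_of_mem hθ_right)
    filter_upwards [hcont.eventually (eventually_gt_nhds hpos)] with t ht using ht.le

theorem eventually_nonneg_right_of_deriv_pos {k : ℝ → ℝ} {a : ℝ} (hk : 0 < deriv k a)
    (h₀ : k a = 0) : ∀ᶠ t in 𝓝[>] a, 0 ≤ k t := by
  filter_upwards [(eventually_nhdsWithin_sign_eq_of_deriv_pos hk h₀).filter_mono
    nhdsWithin_le_nhds, self_mem_nhdsWithin] with t hsign (ht : a < t)
  rw [sign_pos (sub_pos.2 ht), sign_eq_one_iff] at hsign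
  exact hsign.le

variable {V : Type*} [NormedAddCommGroup V] [NormedSpace ℝ V] {H : ℝ × V → ℝ} {a : ℝ} {z u : V}

theorem nonneg_on_tilted_ray {b κ : ℝ} (hab : a ≤ b) (hκ : 0 < κ) (h₀ : H (a, z) = 0)
    (hH : ∀ t ∈ Icc a b, DifferentiableAt ℝ H (t, z + (κ * (t - a)) • u))
    (hu : ∀ t ∈ Icc a b, 0 < dirDeriv (0, u) H (t, z + (κ * (t - a)) • u))
    (ht : ∀ t ∈ Icc a b, H (t, z + (κ * (t - a)) • u) = 0 →
      0 ≤ dirDeriv (1, 0) H (t, z + (κ * (t - a)) • u)) :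
    0 ≤ H (b, z + (κ * (b - a)) • u) := by
  have hray : ∀ t : ℝ, HasDerivAt (fun t : ℝ => (t, z + (κ * (t - a)) • u)) (1, κ • u) t := by
    intro t
    have h := ((((hasDerivAt_id t).sub_const a).const_mul κ).smul_const u).const_add z
    rw [mul_one] at h
    exact (hasDerivAt_id t).prodMk h
  have hderiv : ∀ t ∈ Icc a b, HasDerivAt (fun t => H (t, z + (κ * (t - a)) • u))
      (dirDeriv (1, 0) H (t, z + (κ * (t - a)) • u)
        + κ * dirDeriv (0, u) H (t, z + (κ * (t - a)) • u)) t := by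
    intro t htab
    have h := (hH t htab).hasFDerivAt.comp_hasDerivAt t (hray t)
    rw [show ((1 : ℝ), κ • u) = (1, 0) + κ • (0, u) by simp, map_add, map_smul] at h
    exact h
  refine nonneg_of_right_of_zeros (a := a) (k := fun t => H (t, z + (κ * (t - a)) • u))
    (fun t htab => (hderiv t htab).continuousAt.continuousWithinAt) (by simp [h₀])
    (fun t htab hzero => eventually_nonneg_right_of_deriv_pos ?_ hzero) b (right_mem_Icc.2 hab)
  have htab' := Ico_subset_Icc_self htab
  rw [(hderiv t htab').deriv]
  exact add_pos_of_nonneg_of_pos (ht t htab' hzero) (mul_pos hκ (hu t htab'))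

/-- Along the tilted ray `t ↦ z + κ(t - a)u` with `κ > 0`, zeros of `H` are only crossed upwards;
now let `κ → 0`. -/
theorem eventually_nonneg_of_dirDeriv_pos (hH : ContDiffAt ℝ 1 H (a, z)) (h₀ : H (a, z) = 0)
    (hu : 0 < dirDeriv (0, u) H (a, z))
    (ht : ∀ᶠ p in 𝓝 (a, z), H p = 0 → 0 ≤ dirDeriv (1, 0) H p) :
    ∀ᶠ t in 𝓝[>] a, 0 ≤ H (t, z) := by
  have hu' : ∀ᶠ p in 𝓝 (a, z), 0 < dirDeriv (0, u) H p :=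
    (contDiffAt_dirDeriv (m := 0) hH (by norm_num) (0, u)).continuousAt.eventually
      (eventually_gt_nhds hu)
  have hnhds : ∀ᶠ q in 𝓝 (a, (0 : ℝ)), ContDiffAt ℝ 1 H (q.1, z + q.2 • u) ∧
      0 < dirDeriv (0, u) H (q.1, z + q.2 • u) ∧
      (H (q.1, z + q.2 • u) = 0 → 0 ≤ dirDeriv (1, 0) H (q.1, z + q.2 • u)) := by
    have hcont : Tendsto (fun q : ℝ × ℝ => (q.1, z + q.2 • u)) (𝓝 (a, 0)) (𝓝 (a, z)) := by
      have h : ContinuousAt (fun q : ℝ × ℝ => (q.1, z + q.2 • u)) (a, 0) := by fun_prop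
      simpa only [ContinuousAt, zero_smul, add_zero] using h
    exact hcont.eventually ((hH.eventually (by simp)).and (hu'.and ht))
  obtain ⟨ε, hε, hball⟩ := Metric.eventually_nhds_iff.1 hnhds
  filter_upwards [Ioo_mem_nhdsGT (show a < a + ε by linarith)] with b hb
  have hmem : ∀ κ ∈ Ico (0 : ℝ) 1, ∀ t ∈ Icc a b, dist (t, κ * (t - a)) (a, (0 : ℝ)) < ε := by
    intro κ hκ t htab
    have ht₀ : 0 ≤ t - a := sub_nonneg.2 htab.1
    rw [Prod.dist_eq, max_lt_iff, Real.dist_eq, Real.dist_eq, sub_zero, abs_of_nonneg ht₀,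
      abs_of_nonneg (mul_nonneg hκ.1 ht₀)]
    constructor <;> nlinarith [hκ.2, htab.2, hb.2]
  have hray : ∀ κ ∈ Ioo (0 : ℝ) 1, 0 ≤ H (b, z + (κ * (b - a)) • u) := by
    intro κ hκ
    have hκ' := Ioo_subset_Ico_self hκ
    exact nonneg_on_tilted_ray hb.1.le hκ.1 h₀
      (fun t htab => (hball (hmem κ hκ' t htab)).1.differentiableAt one_ne_zero)
      (fun t htab => (hball (hmem κ hκ' t htab)).2.1)
      (fun t htab => (hball (hmem κ hκ' t htab)).2.2)
  have hcont : ContinuousAt (fun κ : ℝ => H (b, z + (κ * (b - a)) • u)) 0 := by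
    have hHb := (hball (hmem 0 (by simp) b (right_mem_Icc.2 hb.1.le))).1.continuousAt
    exact ContinuousAt.comp (g := H) hHb (by fun_prop)
  have hlim : Tendsto (fun κ : ℝ => H (b, z + (κ * (b - a)) • u)) (𝓝[>] 0) (𝓝 (H (b, z))) := by
    simpa only [zero_mul, zero_smul, add_zero] using hcont.tendsto.mono_left nhdsWithin_le_nhds
  refine ge_of_tendsto hlim ?_
  filter_upwards [Ioo_mem_nhdsGT zero_lt_one] with κ hκ using hray κ hκ

end RealFunctions

section PartialDerivatives

variable {V G : Type*} [NormedAddCommGroup V] [NormedSpace ℝ V] [NormedAddCommGroup G]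
  [NormedSpace ℝ G]

theorem dirDeriv_one_zero {F : ℝ × V → G} {t : ℝ} {z : V} (hF : DifferentiableAt ℝ F (t, z)) :
    dirDeriv (1, 0) F (t, z) = deriv (fun s => F (s, z)) t := by
  simpa using (deriv_comp_prodMk_left (γ := fun s => s) hF differentiableAt_id).symm

theorem dirDeriv_dirDeriv_one_zero {F : ℝ × V → G} {t : ℝ} {z : V}
    (hF : ContDiffAt ℝ 2 F (t, z)) :
    dirDeriv (1, 0) (dirDeriv (1, 0) F) (t, z) = deriv (deriv fun s => F (s, z)) t := by
  have h := deriv_deriv_comp_prodMk_left (γ := fun s => s) hF contDiffAt_id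
  simp only [deriv_id'', deriv_const, Prod.mk_zero_zero, jetDeriv_zero_right] at h
  exact h.symm

theorem eventually_deriv_nonneg_of_dirDeriv_pos {F : ℝ × V → ℝ} {a : ℝ} {z u : V}
    (hF : ContDiffAt ℝ 2 F (a, z)) (h₀ : deriv (fun t => F (t, z)) a = 0)
    (hu : 0 < dirDeriv (0, u) (dirDeriv (1, 0) F) (a, z))
    (ht : ∀ᶠ p in 𝓝 (a, z), deriv (fun t => F (t, p.2)) p.1 = 0 →
      0 ≤ deriv (deriv fun t => F (t, p.2)) p.1) :
    ∀ᶠ t in 𝓝[>] a, 0 ≤ deriv (fun t => F (t, z)) t := by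
  have hF_near : ∀ᶠ p in 𝓝 (a, z), ContDiffAt ℝ 2 F p := hF.eventually (by simp)
  have hnonneg : ∀ᶠ t in 𝓝[>] a, 0 ≤ dirDeriv (1, 0) F (t, z) := by
    refine eventually_nonneg_of_dirDeriv_pos (contDiffAt_dirDeriv hF le_rfl _) ?_ hu ?_
    · rwa [dirDeriv_one_zero (hF.differentiableAt two_ne_zero)]
    · filter_upwards [hF_near, ht] with p hp hzero
      rwa [dirDeriv_one_zero (hp.differentiableAt two_ne_zero), dirDeriv_dirDeriv_one_zero hp]
  have hcont : ContinuousAt (fun t : ℝ => (t, z)) a := by fun_prop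
  filter_upwards [hnonneg, (hcont.eventually hF_near).filter_mono nhdsWithin_le_nhds] with t h hF
  rwa [dirDeriv_one_zero (hF.differentiableAt two_ne_zero)] at h

end PartialDerivatives

section ModelSpace

variable {n : ℕ} {M : Type*} [TopologicalSpace M] [ChartedSpace (Euc n) M]
  [IsManifold (𝓡 n) ∞ M] {N : Type*}

/-- The metric at `x` as a bilinear form on the model space, to which `T_x M` unfolds. Stating it
there makes the normed space structure of `Euc n` available; likewise for the notions below. -/
def metricAt (g : RMetric n M) (x : M) : Euc n →L[ℝ] Euc n →L[ℝ] ℝ := g.inner x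

/-- The inverse of `metricAt g x`, that is `sharp`, on the model space. -/
def sharpAt (g : RMetric n M) (x : M) : (Euc n →L[ℝ] ℝ) →L[ℝ] Euc n := sharp g x

/-- The covector `-∇_x c(x, y)`, that is `momentum`, on the model space. -/
def momentumAt (g : RMetric n M) (c : M → N → ℝ) (x : M) (y : N) : Euc n := momentum g c x y

/-- The `c`-exponential map on the model space. -/
def cExpAt [Nonempty N] (g : RMetric n M) (c : M → N → ℝ) (Λ : Set N) (x : M) (p : Euc n) : N :=
  cExp g c Λ x p

/-- The differential of a function at `x`, as a covector on the model space. -/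
def differentialAt (n : ℕ) {M : Type*} [TopologicalSpace M] [ChartedSpace (Euc n) M] (f : M → ℝ)
    (x : M) : Euc n →L[ℝ] ℝ :=
  mfderiv (𝓡 n) 𝓘(ℝ, ℝ) f x

/-- The Christoffel symbols on the model space. -/
def christoffelAt (g : RMetric n M) (x : M) (u v : Euc n) : Euc n := christoffel g x u v

/-- The Riemannian Hessian on the model space. -/
def hessAt (g : RMetric n M) (f : M → ℝ) (x : M) (u v : Euc n) : ℝ := hess g f x u v

/-- The `c`-sectional curvature on the model space. -/
def curvatureAt [Nonempty N] (g : RMetric n M) (c : M → N → ℝ) (Λ : Set N) (x : M) (y : N)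
    (η ξ : Euc n) : ℝ :=
  cSectionalCurvature g c Λ x y η ξ

theorem metricAt_comm (g : RMetric n M) (x : M) (u v : Euc n) :
    metricAt g x u v = metricAt g x v u := g.symm x u v

theorem metricAt_self_pos (g : RMetric n M) (x : M) {u : Euc n} (hu : u ≠ 0) :
    0 < metricAt g x u u := g.pos x u hu

theorem metricAt_self_nonneg (g : RMetric n M) (x : M) (u : Euc n) : 0 ≤ metricAt g x u u := by
  rcases eq_or_ne u 0 with rfl | hu
  · simp
  · exact (metricAt_self_pos g x hu).le

theorem metricAt_sharpAt (g : RMetric n M) (x : M) (α : Euc n →L[ℝ] ℝ) (u : Euc n) :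
    metricAt g x (sharpAt g x α) u = α u :=
  inner_sharp g x α u

theorem momentumAt_eq_sharpAt (g : RMetric n M) (c : M → N → ℝ) (x : M) (y : N) :
    momentumAt g c x y = sharpAt g x (-differentialAt n (fun x' => c x' y) x) :=
  (map_neg (sharpAt g x) _).symm

theorem cExpAt_mem [Nonempty N] {g : RMetric n M} {c : M → N → ℝ} {Λ : Set N} {x : M} {p : Euc n}
    (hp : p ∈ momentumAt g c x '' Λ) : cExpAt g c Λ x p ∈ Λ :=
  Function.invFunOn_mem hp

theorem momentumAt_cExpAt [Nonempty N] {g : RMetric n M} {c : M → N → ℝ} {Λ : Set N} {x : M}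
    {p : Euc n} (hp : p ∈ momentumAt g c x '' Λ) : momentumAt g c x (cExpAt g c Λ x p) = p :=
  Function.invFunOn_eq hp

end ModelSpace

section SmoothCost

variable {n : ℕ} {M : Type*} [TopologicalSpace M] [ChartedSpace (Euc n) M]
  {N : Type*} [TopologicalSpace N] [ChartedSpace (Euc n) N]

theorem differentialAt_eq_fderiv_chart {f : M → ℝ} {x : M}
    (hf : MDifferentiableAt (𝓡 n) 𝓘(ℝ, ℝ) f x) :
    differentialAt n f x = fderiv ℝ (f ∘ (extChartAt (𝓡 n) x).symm) (extChartAt (𝓡 n) x x) := by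
  have h := hf.mfderiv
  rw [writtenInExtChartAt] at h
  simp only [mfld_simps, fderivWithin_univ] at h
  exact h

theorem eventually_chart_symm_mem {Λ : Set N} (hΛ : IsOpen Λ) {y : N} (hy : y ∈ Λ) :
    ∀ᶠ w in 𝓝 (extChartAt (𝓡 n) y y), (extChartAt (𝓡 n) y).symm w ∈ Λ := by
  refine (continuousAt_extChartAt_symm (I := 𝓡 n) y).eventually ?_
  rw [extChartAt_to_inv]
  exact hΛ.mem_nhds hy

/-- The coordinates of `(x, y)` in the preferred charts at `x` and `y`. -/
def chartPt (n : ℕ) {M : Type*} [TopologicalSpace M] [ChartedSpace (Euc n) M]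
    {N : Type*} [TopologicalSpace N] [ChartedSpace (Euc n) N] (x : M) (y : N) : Euc n × Euc n :=
  (extChartAt (𝓡 n) x x, extChartAt (𝓡 n) y y)

/-- A cost of class `C⁴` on a product of two open sets. -/
structure SmoothCost (n : ℕ) {M : Type*} [TopologicalSpace M] [ChartedSpace (Euc n) M]
    {N : Type*} [TopologicalSpace N] [ChartedSpace (Euc n) N]
    (c : M → N → ℝ) (Ω : Set M) (Λ : Set N) : Prop where
  isOpen_left : IsOpen Ω
  isOpen_right : IsOpen Λ
  contMDiffOn :
    ContMDiffOn ((𝓡 n).prod (𝓡 n)) 𝓘(ℝ, ℝ) 4 (fun p : M × N => c p.1 p.2) (Ω ×ˢ Λ)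

theorem A0.smoothCost {c : M → N → ℝ} {Ω : Set M} {Λ : Set N} (hA0 : A0 n c Ω Λ) (hΩ : IsOpen Ω)
    (hΛ : IsOpen Λ) : SmoothCost n c Ω Λ :=
  ⟨hΩ, hΛ, hA0.1⟩

theorem costInChart_swap (c : M → N → ℝ) (x : M) (y : N) :
    costInChart (n := n) (fun y x => c x y) y x
      = costInChart c x y ∘ ContinuousLinearEquiv.prodComm ℝ (Euc n) (Euc n) := rfl

theorem mixedHess_eq_dirDeriv {c : M → N → ℝ} {x : M} {y : N}
    (hc : ContDiffAt ℝ 2 (costInChart c x y) (chartPt n x y)) (i j : Fin n) :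
    mixedHess n c x y (x, y) i j
      = dirDeriv (0, EuclideanSpace.single j 1) (dirDeriv (EuclideanSpace.single i 1, 0)
          (costInChart c x y)) (chartPt n x y) :=
  (dirDeriv_dirDeriv hc _ _).symm

namespace SmoothCost

variable {c : M → N → ℝ} {Ω : Set M} {Λ : Set N} {x : M} {y : N}

theorem swap (H : SmoothCost n c Ω Λ) : SmoothCost n (fun y x => c x y) Λ Ω where
  isOpen_left := H.isOpen_right
  isOpen_right := H.isOpen_left
  contMDiffOn := H.contMDiffOn.comp (contMDiff_snd.prodMk contMDiff_fst).contMDiffOn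
    fun _ hp => ⟨hp.2, hp.1⟩

theorem contMDiffAt (H : SmoothCost n c Ω Λ) (hx : x ∈ Ω) (hy : y ∈ Λ) :
    ContMDiffAt ((𝓡 n).prod (𝓡 n)) 𝓘(ℝ, ℝ) 4 (fun p : M × N => c p.1 p.2) (x, y) :=
  H.contMDiffOn.contMDiffAt ((H.isOpen_left.prod H.isOpen_right).mem_nhds ⟨hx, hy⟩)

theorem mdifferentiableAt (H : SmoothCost n c Ω Λ) (hx : x ∈ Ω) (hy : y ∈ Λ) :
    MDifferentiableAt (𝓡 n) 𝓘(ℝ, ℝ) (fun x' => c x' y) x :=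
  ContMDiffAt.mdifferentiableAt (n := 4) (ContMDiffAt.comp (g := fun p : M × N => c p.1 p.2) x
    (H.contMDiffAt hx hy) (contMDiffAt_id.prodMk contMDiffAt_const)) four_ne_zero

theorem contDiffAt (H : SmoothCost n c Ω Λ) (hx : x ∈ Ω) (hy : y ∈ Λ) :
    ContDiffAt ℝ 4 (costInChart c x y) (chartPt n x y) := by
  have h := (contMDiffAt_iff.1 (H.contMDiffAt hx hy)).2
  rw [ModelWithCorners.range_eq_univ, contDiffWithinAt_univ, extChartAt_prod] at h
  exact h

theorem eventually_contDiffAt_right (H : SmoothCost n c Ω Λ) (hx : x ∈ Ω) (hy : y ∈ Λ) :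
    ∀ᶠ w in 𝓝 (extChartAt (𝓡 n) y y),
      ContDiffAt ℝ 4 (costInChart c x y) (extChartAt (𝓡 n) x x, w) := by
  have hcont : ContinuousAt (fun w : Euc n => (extChartAt (𝓡 n) x x, w)) (extChartAt (𝓡 n) y y) :=
    by fun_prop
  exact hcont.eventually ((H.contDiffAt hx hy).eventually (by simp))

theorem eventually_contDiffAt_left (H : SmoothCost n c Ω Λ) (hx : x ∈ Ω) (hy : y ∈ Λ) :
    ∀ᶠ z in 𝓝 (extChartAt (𝓡 n) x x),
      ContDiffAt ℝ 4 (costInChart c x y) (z, extChartAt (𝓡 n) y y) := by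
  have hcont : ContinuousAt (fun z : Euc n => (z, extChartAt (𝓡 n) y y)) (extChartAt (𝓡 n) x x) :=
    by fun_prop
  exact hcont.eventually ((H.contDiffAt hx hy).eventually (by simp))

theorem mixedHess_swap (H : SmoothCost n c Ω Λ) (hx : x ∈ Ω) (hy : y ∈ Λ) :
    mixedHess n (fun y x => c x y) y x (y, x) = (mixedHess n c x y (x, y)).transpose := by
  have hc : ContDiffAt ℝ 2 (costInChart c x y) (chartPt n x y) :=
    (H.contDiffAt hx hy).of_le (by norm_num)
  ext i j
  rw [Matrix.transpose_apply, mixedHess_eq_dirDeriv hc,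
    mixedHess_eq_dirDeriv ((H.swap.contDiffAt hy hx).of_le (by norm_num)), dirDeriv_comm hc,
    costInChart_swap, dirDeriv_comp_equiv, dirDeriv_comp_equiv]
  rfl

theorem continuousAt_mixedHess (H : SmoothCost n c Ω Λ) (hx : x ∈ Ω) (hy : y ∈ Λ) :
    ContinuousAt (mixedHess n c x y) (x, y) := by
  have hfderiv : ContinuousAt (fderiv ℝ (fderiv ℝ (costInChart c x y))) (chartPt n x y) :=
    (((H.contDiffAt hx hy).fderiv_right (m := 3) (by norm_num)).fderiv_right
      (m := 2) (by norm_num)).continuousAt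
  have hchart : ContinuousAt
      (fun p : M × N => (extChartAt (𝓡 n) x p.1, extChartAt (𝓡 n) y p.2)) (x, y) :=
    ((continuousAt_extChartAt (I := 𝓡 n) x).comp_of_eq continuousAt_fst rfl).prodMk
      ((continuousAt_extChartAt (I := 𝓡 n) y).comp_of_eq continuousAt_snd rfl)
  refine continuousAt_pi.2 fun i => continuousAt_pi.2 fun j => ?_
  exact ((ContinuousAt.comp (f := fun p : M × N => (extChartAt (𝓡 n) x p.1, extChartAt (𝓡 n) y p.2))
    hfderiv hchart).clm_apply continuousAt_const).clm_apply continuousAt_const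

theorem det_mixedHess_ne_zero (H : SmoothCost n c Ω Λ) (hA2 : A2 n c Ω Λ) (hx : x ∈ Ω)
    (hy : y ∈ Λ) : (mixedHess n c x y (x, y)).det ≠ 0 := by
  have h := hA2 x (subset_closure hx) y (subset_closure hy)
  rwa [extendFrom_eq (subset_closure (mk_mem_prod hx hy))
    ((H.continuousAt_mixedHess hx hy).tendsto.mono_left nhdsWithin_le_nhds)] at h

variable [IsManifold (𝓡 n) ∞ M]

theorem eventually_momentumAt (H : SmoothCost n c Ω Λ) (g : RMetric n M) (hx : x ∈ Ω)
    (hy : y ∈ Λ) :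
    ∀ᶠ w in 𝓝 (extChartAt (𝓡 n) y y), momentumAt g c x ((extChartAt (𝓡 n) y).symm w)
      = sharpAt g x (-(fderiv ℝ (costInChart c x y) (extChartAt (𝓡 n) x x, w)).comp
          (ContinuousLinearMap.inl ℝ (Euc n) (Euc n))) := by
  filter_upwards [eventually_chart_symm_mem H.isOpen_right hy, H.eventually_contDiffAt_right hx hy]
    with w hw hcw
  rw [momentumAt_eq_sharpAt, differentialAt_eq_fderiv_chart (H.mdifferentiableAt hx hw),
    ← (HasFDerivAt.comp (f := (·, w)) _ (hcw.differentiableAt four_ne_zero).hasFDerivAt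
      (hasFDerivAt_prodMk_left _ w)).fderiv]
  rfl

theorem eventually_metricAt_momentumAt (H : SmoothCost n c Ω Λ) (g : RMetric n M) (hx : x ∈ Ω)
    (hy : y ∈ Λ) :
    ∀ᶠ w in 𝓝 (extChartAt (𝓡 n) y y), ∀ u : Euc n,
      metricAt g x (momentumAt g c x ((extChartAt (𝓡 n) y).symm w)) u
        = -dirDeriv (u, 0) (costInChart c x y) (extChartAt (𝓡 n) x x, w) := by
  filter_upwards [H.eventually_momentumAt g hx hy] with w hw u
  rw [hw, metricAt_sharpAt]
  rfl

theorem contDiffAt_momentumAt (H : SmoothCost n c Ω Λ) (g : RMetric n M) (hx : x ∈ Ω)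
    (hy : y ∈ Λ) :
    ContDiffAt ℝ 3 (fun w => momentumAt g c x ((extChartAt (𝓡 n) y).symm w))
      (extChartAt (𝓡 n) y y) := by
  have hfderiv : ContDiffAt ℝ 3 (fderiv ℝ (costInChart c x y)) (chartPt n x y) :=
    (H.contDiffAt hx hy).fderiv_right (by norm_num)
  have hcomp : ContDiffAt ℝ 3 (fun w => fderiv ℝ (costInChart c x y) (extChartAt (𝓡 n) x x, w))
      (extChartAt (𝓡 n) y y) :=
    ContDiffAt.comp (f := fun w => (extChartAt (𝓡 n) x x, w)) _ hfderiv (by fun_prop)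
  exact ((sharpAt g x).contDiff.contDiffAt.comp _
    (hcomp.clm_comp contDiffAt_const).neg).congr_of_eventuallyEq (H.eventually_momentumAt g hx hy)

theorem continuousAt_momentumAt (H : SmoothCost n c Ω Λ) (g : RMetric n M) (hx : x ∈ Ω)
    (hy : y ∈ Λ) : ContinuousAt (momentumAt g c x) y := by
  refine (ContinuousAt.comp (f := extChartAt (𝓡 n) y)
    (H.contDiffAt_momentumAt g hx hy).continuousAt (continuousAt_extChartAt y)).congr ?_
  filter_upwards [extChartAt_source_mem_nhds (I := 𝓡 n) y] with y' hy'
  exact congrArg (momentumAt g c x) ((extChartAt (𝓡 n) y).left_inv hy')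

theorem injOn_momentumAt (H : SmoothCost n c Ω Λ) {g : RMetric n M} (hT : Twist g c Ω Λ)
    (hx : x ∈ Ω) : InjOn (momentumAt g c x) Λ := by
  have hext : EqOn (extendFrom Λ (momentumAt g c x)) (momentumAt g c x) Λ := fun y hy =>
    extendFrom_eq (subset_closure hy)
      ((H.continuousAt_momentumAt g hx hy).tendsto.mono_left nhdsWithin_le_nhds)
  exact ((hT x hx).mono subset_closure).congr hext

theorem metricAt_fderiv_momentumAt (H : SmoothCost n c Ω Λ) (g : RMetric n M) (hx : x ∈ Ω)
    (hy : y ∈ Λ) (u v : Euc n) :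
    metricAt g x (fderiv ℝ (fun w => momentumAt g c x ((extChartAt (𝓡 n) y).symm w))
        (extChartAt (𝓡 n) y y) v) u
      = -dirDeriv (0, v) (dirDeriv (u, 0) (costInChart c x y)) (chartPt n x y) := by
  have hP := ((H.contDiffAt_momentumAt g hx hy).differentiableAt three_ne_zero).hasFDerivAt
  have hc := differentiableAt_dirDeriv ((H.contDiffAt hx hy).of_le (by norm_num)) (u, 0)
  have hright := HasFDerivAt.comp (f := (extChartAt (𝓡 n) x x, ·)) _ hc.hasFDerivAt
    (hasFDerivAt_prodMk_right _ (extChartAt (𝓡 n) y y))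
  have heq : (fun w => metricAt g x (momentumAt g c x ((extChartAt (𝓡 n) y).symm w)) u)
      =ᶠ[𝓝 (extChartAt (𝓡 n) y y)]
        fun w => -dirDeriv (u, 0) (costInChart c x y) (extChartAt (𝓡 n) x x, w) := by
    filter_upwards [H.eventually_metricAt_momentumAt g hx hy] with w hw using hw u
  exact congrArg (· v) ((((metricAt g x).flip u).hasFDerivAt.comp _ hP).unique
    (hright.neg.congr_of_eventuallyEq heq))

theorem exists_dual_velocity (H : SmoothCost n c Ω Λ) (g : RMetric n M) (hx : x ∈ Ω) (hy : y ∈ Λ)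
    (b : Euc n) : ∃ ξ : Euc n, ∀ u : Euc n,
      dirDeriv (0, b) (dirDeriv (u, 0) (costInChart c x y)) (chartPt n x y)
        = -metricAt g x ξ u := by
  refine ⟨sharpAt g x (-(fderiv ℝ (fderiv ℝ (costInChart c x y)) (chartPt n x y) (0, b)).comp
    (ContinuousLinearMap.inl ℝ (Euc n) (Euc n))), fun u => ?_⟩
  rw [metricAt_sharpAt, dirDeriv_dirDeriv ((H.contDiffAt hx hy).of_le (by norm_num))]
  exact (neg_neg _).symm

theorem dirDeriv_costInChart (H : SmoothCost n c Ω Λ) (g : RMetric n M) (hx : x ∈ Ω) (hy : y ∈ Λ)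
    (u : Euc n) :
    dirDeriv (u, 0) (costInChart c x y) (chartPt n x y) = -metricAt g x (momentumAt g c x y) u := by
  have h := (H.eventually_metricAt_momentumAt g hx hy).self_of_nhds u
  rw [extChartAt_to_inv] at h
  rw [h, neg_neg, chartPt]

end SmoothCost

end SmoothCost

section RegularCost

variable {n : ℕ} {M : Type*} [TopologicalSpace M] [ChartedSpace (Euc n) M]
  [IsManifold (𝓡 n) ∞ M] {N : Type*} [TopologicalSpace N] [ChartedSpace (Euc n) N]

/-- The hypotheses on a cost seen from the left factor: a smooth cost with nondegenerate mixed
second derivatives, such that `y ↦ -∇_x c(x, y)` is injective with convex range. -/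
structure RegularCost (g : RMetric n M) (c : M → N → ℝ) (Ω : Set M) (Λ : Set N) : Prop
    extends SmoothCost n c Ω Λ where
  det_ne_zero : ∀ x ∈ Ω, ∀ y ∈ Λ, (mixedHess n c x y (x, y)).det ≠ 0
  injOn : ∀ x ∈ Ω, InjOn (momentumAt g c x) Λ
  convex : ∀ x ∈ Ω, Convex ℝ (momentumAt g c x '' Λ)

theorem eq_zero_of_det_ne_zero {β : Euc n →L[ℝ] Euc n →L[ℝ] ℝ}
    (hβ : (Matrix.of fun i j : Fin n =>
      β (EuclideanSpace.single j 1) (EuclideanSpace.single i 1)).det ≠ 0)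
    {v : Euc n} (hv : ∀ u, β v u = 0) : v = 0 := by
  let b : Module.Basis (Fin n) ℝ (Euc n) := (EuclideanSpace.basisFun (Fin n) ℝ).toBasis
  have hsep : β.toLinearMap₁₂.SeparatingLeft := by
    rw [LinearMap.separatingLeft_iff_det_ne_zero b, ← Matrix.det_transpose]
    convert hβ using 2
    ext i j
    simp [b, LinearMap.toMatrix₂_apply]
  exact hsep v hv

namespace RegularCost

variable {g : RMetric n M} {c : M → N → ℝ} {Ω : Set M} {Λ : Set N} {x : M} {y : N}

theorem eq_zero_of_dirDeriv (H : RegularCost g c Ω Λ) (hx : x ∈ Ω) (hy : y ∈ Λ) {v : Euc n}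
    (hv : ∀ u : Euc n,
      dirDeriv (0, v) (dirDeriv (u, 0) (costInChart c x y)) (chartPt n x y) = 0) : v = 0 := by
  have hc : ContDiffAt ℝ 2 (costInChart c x y) (chartPt n x y) :=
    (H.contDiffAt hx hy).of_le (by norm_num)
  refine eq_zero_of_det_ne_zero (β := (fderiv ℝ (fderiv ℝ (costInChart c x y))
    (chartPt n x y)).bilinearComp (.inr ℝ (Euc n) (Euc n)) (.inl ℝ (Euc n) (Euc n)))
    (H.det_ne_zero x hx y hy) fun u => ?_
  rw [← hv u, dirDeriv_dirDeriv hc]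
  rfl

theorem add_smul_sub_mem (H : RegularCost g c Ω Λ) (hx : x ∈ Ω) {y₀ y₁ : N} (hy₀ : y₀ ∈ Λ)
    (hy₁ : y₁ ∈ Λ) {t : ℝ} (ht : t ∈ Icc (0 : ℝ) 1) :
    momentumAt g c x y₀ + t • (momentumAt g c x y₁ - momentumAt g c x y₀)
      ∈ momentumAt g c x '' Λ :=
  (H.convex x hx).add_smul_sub_mem (mem_image_of_mem _ hy₀) (mem_image_of_mem _ hy₁) ht

variable [Nonempty N]

theorem cExpAt_momentumAt (H : RegularCost g c Ω Λ) (hx : x ∈ Ω) (hy : y ∈ Λ) :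
    cExpAt g c Λ x (momentumAt g c x y) = y :=
  have hmem : momentumAt g c x y ∈ momentumAt g c x '' Λ := mem_image_of_mem _ hy
  H.injOn x hx (cExpAt_mem hmem) hy (momentumAt_cExpAt hmem)

theorem exists_eventually_cExpAt_eq (H : RegularCost g c Ω Λ) (hx : x ∈ Ω) (hy : y ∈ Λ) :
    ∃ σ : Euc n → Euc n, ContDiffAt ℝ 3 σ (momentumAt g c x y) ∧
      ∀ᶠ p in 𝓝 (momentumAt g c x y), p ∈ momentumAt g c x '' Λ ∧
        σ p ∈ (extChartAt (𝓡 n) y).target ∧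
        cExpAt g c Λ x p = (extChartAt (𝓡 n) y).symm (σ p) := by
  set ψ := extChartAt (𝓡 n) y
  have hinj : Function.Injective (fderiv ℝ (fun w => momentumAt g c x (ψ.symm w)) (ψ y)) := by
    rw [injective_iff_map_eq_zero]
    refine fun v hv => H.eq_zero_of_dirDeriv hx hy fun u => ?_
    have h := H.metricAt_fderiv_momentumAt g hx hy u v
    rw [hv, map_zero, zero_apply] at h
    exact neg_eq_zero.1 h.symm
  obtain ⟨σ, hσ, hσ_apply, hσ_inv⟩ := exists_contDiffAt_rightInverse
    (H.contDiffAt_momentumAt g hx hy) three_ne_zero hinj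
  simp only [extChartAt_to_inv] at hσ hσ_apply hσ_inv
  have hlim : Tendsto σ (𝓝 (momentumAt g c x y)) (𝓝 (ψ y)) := by
    simpa only [hσ_apply] using hσ.continuousAt.tendsto
  refine ⟨σ, hσ, ?_⟩
  filter_upwards [hσ_inv, hlim.eventually (eventually_chart_symm_mem H.isOpen_right hy),
    hlim.eventually (extChartAt_target_mem_nhds (I := 𝓡 n) y)] with p hp hmem htarget
  refine ⟨⟨_, hmem, hp⟩, htarget, ?_⟩
  rw [← H.cExpAt_momentumAt hx hmem, hp]

theorem contDiffAt_cExpAt (H : RegularCost g c Ω Λ) (hx : x ∈ Ω) (hy : y ∈ Λ) :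
    ContDiffAt ℝ 3 (fun p => extChartAt (𝓡 n) y (cExpAt g c Λ x p)) (momentumAt g c x y) := by
  obtain ⟨σ, hσ, hσ_eq⟩ := H.exists_eventually_cExpAt_eq hx hy
  refine hσ.congr_of_eventuallyEq ?_
  filter_upwards [hσ_eq] with p ⟨_, htarget, heq⟩
  rw [heq, PartialEquiv.right_inv _ htarget]

theorem eventually_cExpAt_mem (H : RegularCost g c Ω Λ) (hx : x ∈ Ω) (hy : y ∈ Λ) :
    ∀ᶠ p in 𝓝 (momentumAt g c x y), p ∈ momentumAt g c x '' Λ ∧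
      cExpAt g c Λ x p ∈ (extChartAt (𝓡 n) y).source := by
  obtain ⟨σ, -, hσ_eq⟩ := H.exists_eventually_cExpAt_eq hx hy
  filter_upwards [hσ_eq] with p ⟨hp, htarget, heq⟩
  rw [heq]
  exact ⟨hp, (extChartAt (𝓡 n) y).map_target htarget⟩

end RegularCost

end RegularCost

section CLine

variable {n : ℕ} {M : Type*} [TopologicalSpace M] [ChartedSpace (Euc n) M]
  [IsManifold (𝓡 n) ∞ M] {N : Type*} [TopologicalSpace N] [ChartedSpace (Euc n) N] [Nonempty N]

/-- The curve `t ↦ c-Exp_x(A + tB)`, which runs through a `c`-segment with respect to `x`. -/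
def cLine (g : RMetric n M) (c : M → N → ℝ) (Λ : Set N) (x : M) (A B : Euc n) (t : ℝ) : N :=
  cExpAt g c Λ x (A + t • B)

/-- The curve `cLine` in the preferred chart at `y`. -/
def cLineChart (g : RMetric n M) (c : M → N → ℝ) (Λ : Set N) (x : M) (A B : Euc n) (y : N)
    (t : ℝ) : Euc n :=
  extChartAt (𝓡 n) y (cLine g c Λ x A B t)

theorem deriv_map_line {V G : Type*} [NormedAddCommGroup V] [NormedSpace ℝ V]
    [NormedAddCommGroup G] [NormedSpace ℝ G] (L : V →L[ℝ] G) (A B : V) :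
    deriv (fun t : ℝ => L (A + t • B)) = fun _ => L B := by
  funext t
  have h : HasDerivAt (fun t : ℝ => A + t • B) B t := by
    simpa using ((hasDerivAt_id t).smul_const B).const_add A
  exact (L.hasFDerivAt.comp_hasDerivAt t h).deriv

namespace RegularCost

variable {g : RMetric n M} {c : M → N → ℝ} {Ω : Set M} {Λ : Set N} {x : M} {y : N} {A B : Euc n}
  {t₀ : ℝ}

theorem cLine_eq (H : RegularCost g c Ω Λ) (hx : x ∈ Ω) (hy : y ∈ Λ)
    (hy_eq : A + t₀ • B = momentumAt g c x y) : cLine g c Λ x A B t₀ = y := by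
  rw [cLine, hy_eq, H.cExpAt_momentumAt hx hy]

theorem cLineChart_eq (H : RegularCost g c Ω Λ) (hx : x ∈ Ω) (hy : y ∈ Λ)
    (hy_eq : A + t₀ • B = momentumAt g c x y) :
    cLineChart g c Λ x A B y t₀ = extChartAt (𝓡 n) y y := by
  rw [cLineChart, H.cLine_eq hx hy hy_eq]

theorem prodMk_cLineChart_eq (H : RegularCost g c Ω Λ) (hx : x ∈ Ω) (hy : y ∈ Λ)
    (hy_eq : A + t₀ • B = momentumAt g c x y) :
    (extChartAt (𝓡 n) x x, cLineChart g c Λ x A B y t₀) = chartPt n x y := by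
  rw [H.cLineChart_eq hx hy hy_eq, chartPt]

theorem cLine_segment_mem (H : RegularCost g c Ω Λ) (hx : x ∈ Ω) {y₀ y₁ : N} (hy₀ : y₀ ∈ Λ)
    (hy₁ : y₁ ∈ Λ) {t : ℝ} (ht : t ∈ Icc (0 : ℝ) 1) :
    cLine g c Λ x (momentumAt g c x y₀) (momentumAt g c x y₁ - momentumAt g c x y₀) t ∈ Λ ∧
      momentumAt g c x y₀ + t • (momentumAt g c x y₁ - momentumAt g c x y₀) = momentumAt g c x
        (cLine g c Λ x (momentumAt g c x y₀) (momentumAt g c x y₁ - momentumAt g c x y₀) t) :=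
  have hmem := H.add_smul_sub_mem hx hy₀ hy₁ ht
  ⟨cExpAt_mem hmem, (momentumAt_cExpAt hmem).symm⟩

theorem contDiffAt_cLineChart (H : RegularCost g c Ω Λ) (hx : x ∈ Ω) (hy : y ∈ Λ)
    (hy_eq : A + t₀ • B = momentumAt g c x y) : ContDiffAt ℝ 3 (cLineChart g c Λ x A B y) t₀ := by
  have h := H.contDiffAt_cExpAt hx hy
  rw [← hy_eq] at h
  exact ContDiffAt.comp (f := fun t : ℝ => A + t • B) t₀ h (by fun_prop)

theorem eventually_cLine_mem (H : RegularCost g c Ω Λ) (hx : x ∈ Ω) (hy : y ∈ Λ)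
    (hy_eq : A + t₀ • B = momentumAt g c x y) :
    ∀ᶠ t in 𝓝 t₀, A + t • B ∈ momentumAt g c x '' Λ ∧
      (extChartAt (𝓡 n) y).symm (cLineChart g c Λ x A B y t) = cLine g c Λ x A B t := by
  have h := H.eventually_cExpAt_mem hx hy
  rw [← hy_eq] at h
  have hcont : ContinuousAt (fun t : ℝ => A + t • B) t₀ := by fun_prop
  filter_upwards [hcont.eventually h] with t ⟨ht, hsource⟩
  exact ⟨ht, (extChartAt (𝓡 n) y).left_inv hsource⟩

theorem eventually_cLineChart (H : RegularCost g c Ω Λ) (hx : x ∈ Ω) (hy : y ∈ Λ)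
    (hy_eq : A + t₀ • B = momentumAt g c x y) {p : Euc n → Prop}
    (hp : ∀ᶠ w in 𝓝 (extChartAt (𝓡 n) y y), p w) :
    ∀ᶠ t in 𝓝 t₀, p (cLineChart g c Λ x A B y t) := by
  rw [← H.cLineChart_eq hx hy hy_eq] at hp
  exact (H.contDiffAt_cLineChart hx hy hy_eq).continuousAt.eventually hp

theorem eventually_dirDeriv_cLineChart (H : RegularCost g c Ω Λ) (hx : x ∈ Ω) (hy : y ∈ Λ)
    (hy_eq : A + t₀ • B = momentumAt g c x y) (u : Euc n) :
    (fun t => dirDeriv (u, 0) (costInChart c x y)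
      (extChartAt (𝓡 n) x x, cLineChart g c Λ x A B y t))
      =ᶠ[𝓝 t₀] fun t => (-(metricAt g x).flip u) (A + t • B) := by
  filter_upwards [H.eventually_cLineChart hx hy hy_eq (H.eventually_metricAt_momentumAt g hx hy),
    H.eventually_cLine_mem hx hy hy_eq] with t hmetric ht
  rw [ht.2, cLine] at hmetric
  rw [← neg_eq_iff_eq_neg.2 (hmetric u), momentumAt_cExpAt ht.1]
  rfl

theorem dirDeriv_velocity (H : RegularCost g c Ω Λ) (hx : x ∈ Ω) (hy : y ∈ Λ)
    (hy_eq : A + t₀ • B = momentumAt g c x y) (u : Euc n) :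
    dirDeriv (0, deriv (cLineChart g c Λ x A B y) t₀) (dirDeriv (u, 0) (costInChart c x y))
      (chartPt n x y) = -metricAt g x B u := by
  have hc := differentiableAt_dirDeriv ((H.contDiffAt hx hy).of_le (by norm_num)) (u, 0)
  rw [← H.prodMk_cLineChart_eq hx hy hy_eq] at hc ⊢
  rw [← deriv_comp_prodMk_right hc
      ((H.contDiffAt_cLineChart hx hy hy_eq).differentiableAt three_ne_zero),
    (H.eventually_dirDeriv_cLineChart hx hy hy_eq u).deriv_eq, deriv_map_line]
  rfl

theorem jetDeriv_acceleration (H : RegularCost g c Ω Λ) (hx : x ∈ Ω) (hy : y ∈ Λ)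
    (hy_eq : A + t₀ • B = momentumAt g c x y) (u : Euc n) :
    jetDeriv (0, deriv (cLineChart g c Λ x A B y) t₀)
      (0, deriv (deriv (cLineChart g c Λ x A B y)) t₀)
      (dirDeriv (u, 0) (costInChart c x y)) (chartPt n x y) = 0 := by
  have hc := contDiffAt_dirDeriv (m := 2) (H.contDiffAt hx hy) (by norm_num) (u, 0)
  rw [← H.prodMk_cLineChart_eq hx hy hy_eq] at hc ⊢
  rw [← deriv_deriv_comp_prodMk_right hc
      ((H.contDiffAt_cLineChart hx hy hy_eq).of_le (by norm_num)),
    (H.eventually_dirDeriv_cLineChart hx hy hy_eq u).deriv.deriv_eq, deriv_map_line, deriv_const]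

theorem velocity_ne_zero (H : RegularCost g c Ω Λ) (hx : x ∈ Ω) (hy : y ∈ Λ)
    (hy_eq : A + t₀ • B = momentumAt g c x y) (hB : B ≠ 0) :
    deriv (cLineChart g c Λ x A B y) t₀ ≠ 0 := by
  intro hv
  have h := H.dirDeriv_velocity hx hy hy_eq B
  rw [hv, Prod.mk_zero_zero, dirDeriv_zero] at h
  exact (metricAt_self_pos g x hB).ne (neg_eq_zero.1 h.symm).symm

theorem velocity_eq (H : RegularCost g c Ω Λ) (hx : x ∈ Ω) (hy : y ∈ Λ)
    (hy_eq : A + t₀ • B = momentumAt g c x y) {v : Euc n}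
    (hv : ∀ u : Euc n, dirDeriv (0, v) (dirDeriv (u, 0) (costInChart c x y)) (chartPt n x y)
      = -metricAt g x B u) : deriv (cLineChart g c Λ x A B y) t₀ = v := by
  refine sub_eq_zero.1 (H.eq_zero_of_dirDeriv hx hy fun u => ?_)
  have hsub : ((0 : Euc n), deriv (cLineChart g c Λ x A B y) t₀ - v)
      = (0, deriv (cLineChart g c Λ x A B y) t₀) - (0, v) := by simp
  rw [hsub, dirDeriv, map_sub]
  exact sub_eq_zero.2 ((H.dirDeriv_velocity hx hy hy_eq u).trans (hv u).symm)

end RegularCost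

end CLine

section Curvature

variable {n : ℕ} {M : Type*} [TopologicalSpace M] [ChartedSpace (Euc n) M]
  [IsManifold (𝓡 n) ∞ M] {N : Type*} [TopologicalSpace N] [ChartedSpace (Euc n) N]
  {g : RMetric n M} {c : M → N → ℝ} {Ω : Set M} {Λ : Set N} {x : M} {y : N}

theorem hessAt_chart_symm (g : RMetric n M) {w : Euc n}
    (hc : ContDiffAt ℝ 2 (costInChart c x y) (extChartAt (𝓡 n) x x, w)) (u v : Euc n) :
    hessAt g (fun x' => c x' ((extChartAt (𝓡 n) y).symm w)) x u v
      = dirDeriv (u, 0) (dirDeriv (v, 0) (costInChart c x y)) (extChartAt (𝓡 n) x x, w)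
        + metricAt g x (momentumAt g c x ((extChartAt (𝓡 n) y).symm w))
          (christoffelAt g x u v) := by
  have hslice : ContDiffAt ℝ 2 (fun z => costInChart c x y (z, w)) (extChartAt (𝓡 n) x x) :=
    ContDiffAt.comp (f := (·, w)) _ hc (by fun_prop)
  have hsecond : fderiv ℝ (fderiv ℝ fun z => costInChart c x y (z, w)) (extChartAt (𝓡 n) x x) u v
      = dirDeriv (u, 0) (dirDeriv (v, 0) (costInChart c x y)) (extChartAt (𝓡 n) x x, w) := by
    rw [← dirDeriv_dirDeriv hslice]
    exact dirDeriv_dirDeriv_comp (ι := (·, w)) (fun z => hasFDerivAt_prodMk_left z w) hc u v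
  rw [momentumAt_eq_sharpAt, metricAt_sharpAt, ← hsecond]
  exact sub_eq_add_neg _ _

variable [Nonempty N]

theorem RegularCost.eventually_hessAt_cLine (H : RegularCost g c Ω Λ) (hx : x ∈ Ω) (hy : y ∈ Λ)
    {A B : Euc n} {t₀ : ℝ} (hy_eq : A + t₀ • B = momentumAt g c x y) (η : Euc n) :
    (fun t => -hessAt g (fun x' => c x' (cLine g c Λ x A B t)) x η η)
      =ᶠ[𝓝 t₀] fun t => -dirDeriv (η, 0) (dirDeriv (η, 0) (costInChart c x y))
          (extChartAt (𝓡 n) x x, cLineChart g c Λ x A B y t)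
        - metricAt g x (A + t • B) (christoffelAt g x η η) := by
  filter_upwards [H.eventually_cLine_mem hx hy hy_eq,
    H.eventually_cLineChart hx hy hy_eq (H.eventually_contDiffAt_right hx hy)] with t ht hct
  have h := hessAt_chart_symm g (hct.of_le (by norm_num)) η η
  rw [ht.2] at h
  rw [h, cLine, momentumAt_cExpAt ht.1, neg_add]
  rfl

/-- The Christoffel term of the Hessian is affine along a `c`-segment, so it does not contribute
to the curvature. -/
theorem RegularCost.curvatureAt_eq (H : RegularCost g c Ω Λ) (hx : x ∈ Ω) (hy : y ∈ Λ)
    (η ξ : Euc n) :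
    curvatureAt g c Λ x y η ξ
      = -jetDeriv (0, deriv (cLineChart g c Λ x (momentumAt g c x y) ξ y) 0)
          (0, deriv (deriv (cLineChart g c Λ x (momentumAt g c x y) ξ y)) 0)
          (dirDeriv (η, 0) (dirDeriv (η, 0) (costInChart c x y))) (chartPt n x y) := by
  set A := momentumAt g c x y
  have hy_eq : A + (0 : ℝ) • ξ = momentumAt g c x y := by rw [zero_smul, add_zero]
  have hw : ContDiffAt ℝ 2 (cLineChart g c Λ x A ξ y) 0 :=
    (H.contDiffAt_cLineChart hx hy hy_eq).of_le (by norm_num)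
  have hc := contDiffAt_dirDeriv (m := 2) (contDiffAt_dirDeriv (m := 3) (H.contDiffAt hx hy)
    (by norm_num) (η, 0)) (by norm_num) (η, 0)
  rw [← H.prodMk_cLineChart_eq hx hy hy_eq] at hc ⊢
  have hcw : ContDiffAt ℝ 2 (fun t => dirDeriv (η, 0) (dirDeriv (η, 0) (costInChart c x y))
      (extChartAt (𝓡 n) x x, cLineChart g c Λ x A ξ y t)) 0 :=
    ContDiffAt.comp (f := fun t => (extChartAt (𝓡 n) x x, cLineChart g c Λ x A ξ y t)) 0 hc
      (contDiffAt_const.prodMk hw)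
  have haffine : ContDiffAt ℝ 2
      (fun t : ℝ => metricAt g x (A + t • ξ) (christoffelAt g x η η)) 0 := by fun_prop
  have hlinear : iteratedDeriv 2
      (fun t : ℝ => metricAt g x (A + t • ξ) (christoffelAt g x η η)) 0 = 0 := by
    have h := deriv_map_line ((metricAt g x).flip (christoffelAt g x η η)) A ξ
    simp only [ContinuousLinearMap.flip_apply] at h
    rw [iteratedDeriv_succ, iteratedDeriv_one, h, deriv_const]
  calc curvatureAt g c Λ x y η ξ
      = iteratedDeriv 2 (fun t => -hessAt g (fun x' => c x' (cLine g c Λ x A ξ t)) x η η) 0 := rfl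
    _ = -iteratedDeriv 2 (fun t => dirDeriv (η, 0) (dirDeriv (η, 0) (costInChart c x y))
          (extChartAt (𝓡 n) x x, cLineChart g c Λ x A ξ y t)) 0 := by
        rw [(H.eventually_hessAt_cLine hx hy hy_eq η).iteratedDeriv_eq,
          iteratedDeriv_fun_sub hcw.neg haffine, hlinear, sub_zero, iteratedDeriv_fun_neg]
    _ = _ := by rw [iteratedDeriv_succ, iteratedDeriv_one, deriv_deriv_comp_prodMk_right hc hw]

end Curvature

section DualLine

variable {n : ℕ} {M : Type*} [TopologicalSpace M] [ChartedSpace (Euc n) M] [Nonempty M]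
  {N : Type*} [TopologicalSpace N] [ChartedSpace (Euc n) N] [IsManifold (𝓡 n) ∞ N]
  {h : RMetric n N} {c : M → N → ℝ} {Ω : Set M} {Λ : Set N} {x : M} {y : N} {A B : Euc n} {s : ℝ}

namespace RegularCost

theorem dirDeriv_velocity_swap (H : RegularCost h (fun y x => c x y) Λ Ω) (hx : x ∈ Ω)
    (hy : y ∈ Λ) (hx_eq : A + s • B = momentumAt h (fun y x => c x y) y x) (b : Euc n) :
    dirDeriv (deriv (cLineChart h (fun y x => c x y) Ω y A B x) s, 0)
      (dirDeriv (0, b) (costInChart c x y)) (chartPt n x y) = -metricAt h y B b := by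
  have hvel := H.dirDeriv_velocity hy hx hx_eq b
  rw [costInChart_swap, dirDeriv_comp_equiv, dirDeriv_comp_equiv] at hvel
  exact hvel

theorem jetDeriv_acceleration_swap (H : RegularCost h (fun y x => c x y) Λ Ω) (hx : x ∈ Ω)
    (hy : y ∈ Λ) (hx_eq : A + s • B = momentumAt h (fun y x => c x y) y x) (u : Euc n) :
    jetDeriv (deriv (cLineChart h (fun y x => c x y) Ω y A B x) s, 0)
      (deriv (deriv (cLineChart h (fun y x => c x y) Ω y A B x)) s, 0)
      (dirDeriv (0, u) (costInChart c x y)) (chartPt n x y) = 0 := by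
  have hacc := H.jetDeriv_acceleration hy hx hx_eq u
  rw [costInChart_swap, dirDeriv_comp_equiv, jetDeriv_comp_equiv] at hacc
  exact hacc

theorem contDiffAt_jetDeriv_comp_cLine (H : SmoothCost n c Ω Λ)
    (H' : RegularCost h (fun y x => c x y) Λ Ω) (hx : x ∈ Ω) (hy : y ∈ Λ)
    (hx_eq : A + s • B = momentumAt h (fun y x => c x y) y x) (b b' : Euc n) :
    ContDiffAt ℝ 2 (jetDeriv (0, b) (0, b') (costInChart c x y))
      (cLineChart h (fun y x => c x y) Ω y A B x s, extChartAt (𝓡 n) y y) := by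
  rw [H'.cLineChart_eq hy hx hx_eq]
  exact contDiffAt_jetDeriv (H.contDiffAt hx hy) (by norm_num) _ _

end RegularCost

end DualLine

section CrossCurvature

variable {n : ℕ} {M : Type*} [TopologicalSpace M] [ChartedSpace (Euc n) M]
  [IsManifold (𝓡 n) ∞ M] {N : Type*} [TopologicalSpace N] [ChartedSpace (Euc n) N] [Nonempty N]

/-- The derivative of `t ↦ c(x, γ(t))` at `θ`. -/
def costVelocity (c : M → N → ℝ) (γ : ℝ → N) (θ : ℝ) (x : M) : ℝ :=
  deriv (fun t => c x (γ t)) θ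

/-- The second derivative of `t ↦ c(x, γ(t))` at `θ`. -/
def costAcceleration (c : M → N → ℝ) (γ : ℝ → N) (θ : ℝ) (x : M) : ℝ :=
  deriv (deriv fun t => c x (γ t)) θ

namespace RegularCost

variable {g : RMetric n M} {c : M → N → ℝ} {Ω : Set M} {Λ : Set N} {xm x : M} {y : N}
  {A B : Euc n} {θ : ℝ}

theorem eventually_cost_cLine_eq (H : RegularCost g c Ω Λ) (hxm : xm ∈ Ω) (hy : y ∈ Λ)
    (hy_eq : A + θ • B = momentumAt g c xm y) (x : M) (z : Euc n) :
    (fun t => c ((extChartAt (𝓡 n) x).symm z) (cLine g c Λ xm A B t))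
      =ᶠ[𝓝 θ] fun t => costInChart c x y (z, cLineChart g c Λ xm A B y t) := by
  filter_upwards [H.eventually_cLine_mem hxm hy hy_eq] with t ht
  rw [← ht.2, costInChart]

theorem eventually_costVelocity (H : RegularCost g c Ω Λ) (hxm : xm ∈ Ω) (hy : y ∈ Λ)
    (hy_eq : A + θ • B = momentumAt g c xm y) (hx : x ∈ Ω) :
    ∀ᶠ z in 𝓝 (extChartAt (𝓡 n) x x),
      costVelocity c (cLine g c Λ xm A B) θ ((extChartAt (𝓡 n) x).symm z)
        = dirDeriv (0, deriv (cLineChart g c Λ xm A B y) θ) (costInChart c x y)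
          (z, extChartAt (𝓡 n) y y) := by
  filter_upwards [H.eventually_contDiffAt_left hx hy] with z hz
  rw [← H.cLineChart_eq hxm hy hy_eq] at hz ⊢
  rw [costVelocity, (H.eventually_cost_cLine_eq hxm hy hy_eq x z).deriv_eq,
    deriv_comp_prodMk_right (hz.differentiableAt four_ne_zero)
      ((H.contDiffAt_cLineChart hxm hy hy_eq).differentiableAt three_ne_zero)]

theorem eventually_costAcceleration (H : RegularCost g c Ω Λ) (hxm : xm ∈ Ω) (hy : y ∈ Λ)
    (hy_eq : A + θ • B = momentumAt g c xm y) (hx : x ∈ Ω) :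
    ∀ᶠ z in 𝓝 (extChartAt (𝓡 n) x x),
      costAcceleration c (cLine g c Λ xm A B) θ ((extChartAt (𝓡 n) x).symm z)
        = jetDeriv (0, deriv (cLineChart g c Λ xm A B y) θ)
          (0, deriv (deriv (cLineChart g c Λ xm A B y)) θ) (costInChart c x y)
          (z, extChartAt (𝓡 n) y y) := by
  filter_upwards [H.eventually_contDiffAt_left hx hy] with z hz
  rw [← H.cLineChart_eq hxm hy hy_eq] at hz ⊢
  rw [costAcceleration, (H.eventually_cost_cLine_eq hxm hy hy_eq x z).deriv.deriv_eq,
    deriv_deriv_comp_prodMk_right (hz.of_le (by norm_num))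
      ((H.contDiffAt_cLineChart hxm hy hy_eq).of_le (by norm_num))]

variable [IsManifold (𝓡 n) ∞ N]

theorem costVelocity_cLine (H : RegularCost g c Ω Λ) (h : RMetric n N) (hxm : xm ∈ Ω)
    (hy : y ∈ Λ) (hy_eq : A + θ • B = momentumAt g c xm y) (hx : x ∈ Ω) :
    costVelocity c (cLine g c Λ xm A B) θ x
      = -metricAt h y (momentumAt h (fun y x => c x y) y x)
          (deriv (cLineChart g c Λ xm A B y) θ) := by
  have hvel := (H.eventually_costVelocity hxm hy hy_eq hx).self_of_nhds
  rw [extChartAt_to_inv] at hvel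
  rw [hvel, ← H.swap.dirDeriv_costInChart h hy hx, costInChart_swap, dirDeriv_comp_equiv]
  rfl

variable {h : RMetric n N} {x₀ : M} {A' B' : Euc n} {s₀ : ℝ}

section

variable [Nonempty M]

theorem jetDeriv_jetDeriv_eq_neg_curvatureAt (H : RegularCost g c Ω Λ)
    (H' : RegularCost h (fun y x => c x y) Λ Ω) (hx₀ : x₀ ∈ Ω) (hy : y ∈ Λ)
    (hx_eq : A' + s₀ • B' = momentumAt h (fun y x => c x y) y x₀) {b ξ : Euc n} (b' : Euc n)
    (hξ : ∀ u : Euc n, dirDeriv (0, b) (dirDeriv (u, 0) (costInChart c x₀ y)) (chartPt n x₀ y)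
      = -metricAt g x₀ ξ u) :
    jetDeriv (deriv (cLineChart h (fun y x => c x y) Ω y A' B' x₀) s₀, 0)
        (deriv (deriv (cLineChart h (fun y x => c x y) Ω y A' B' x₀)) s₀, 0)
        (jetDeriv (0, b) (0, b') (costInChart c x₀ y)) (chartPt n x₀ y)
      = -curvatureAt g c Λ x₀ y (deriv (cLineChart h (fun y x => c x y) Ω y A' B' x₀) s₀) ξ := by
  have hy_eq : momentumAt g c x₀ y + (0 : ℝ) • ξ = momentumAt g c x₀ y := by
    rw [zero_smul, add_zero]
  have hacc := H.jetDeriv_acceleration hx₀ hy hy_eq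
  have hb := H.velocity_eq hx₀ hy hy_eq hξ
  rw [H.curvatureAt_eq hx₀ hy, neg_neg, hb]
  rw [hb] at hacc
  exact jetDeriv_jetDeriv_eq (H.contDiffAt hx₀ hy) (H'.jetDeriv_acceleration_swap hx₀ hy hx_eq b')
    (H'.jetDeriv_acceleration_swap hx₀ hy hx_eq _) (hacc _)

theorem eventually_costAcceleration_cLine (H : RegularCost g c Ω Λ)
    (H' : RegularCost h (fun y x => c x y) Λ Ω) (hxm : xm ∈ Ω) (hy : y ∈ Λ)
    (hy_eq : A + θ • B = momentumAt g c xm y) (hx₀ : x₀ ∈ Ω)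
    (hx_eq : A' + s₀ • B' = momentumAt h (fun y x => c x y) y x₀) :
    (fun s => costAcceleration c (cLine g c Λ xm A B) θ (cLine h (fun y x => c x y) Ω y A' B' s))
      =ᶠ[𝓝 s₀] fun s => jetDeriv (0, deriv (cLineChart g c Λ xm A B y) θ)
          (0, deriv (deriv (cLineChart g c Λ xm A B y)) θ) (costInChart c x₀ y)
          (cLineChart h (fun y x => c x y) Ω y A' B' x₀ s, extChartAt (𝓡 n) y y) := by
  filter_upwards [H'.eventually_cLine_mem hy hx₀ hx_eq, H'.eventually_cLineChart hy hx₀ hx_eq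
    (H.eventually_costAcceleration hxm hy hy_eq hx₀)] with s hs hacc
  rw [← hacc, hs.2]

theorem contDiffAt_costAcceleration_cLine (H : RegularCost g c Ω Λ)
    (H' : RegularCost h (fun y x => c x y) Λ Ω) (hxm : xm ∈ Ω) (hy : y ∈ Λ)
    (hy_eq : A + θ • B = momentumAt g c xm y) (hx₀ : x₀ ∈ Ω)
    (hx_eq : A' + s₀ • B' = momentumAt h (fun y x => c x y) y x₀) :
    ContDiffAt ℝ 2 (fun s => costAcceleration c (cLine g c Λ xm A B) θ
      (cLine h (fun y x => c x y) Ω y A' B' s)) s₀ := by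
  refine ContDiffAt.congr_of_eventuallyEq ?_
    (H.eventually_costAcceleration_cLine H' hxm hy hy_eq hx₀ hx_eq)
  exact ContDiffAt.comp
    (f := fun s => (cLineChart h (fun y x => c x y) Ω y A' B' x₀ s, extChartAt (𝓡 n) y y)) s₀
    (contDiffAt_jetDeriv_comp_cLine H.toSmoothCost H' hx₀ hy hx_eq _ _)
    (((H'.contDiffAt_cLineChart hy hx₀ hx_eq).of_le (by norm_num)).prodMk contDiffAt_const)

/-- This holds because `∂_x c(x_m, y_θ)` is affine in `θ`. -/
theorem deriv_costAcceleration_cLine_eq_zero (H : RegularCost g c Ω Λ)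
    (H' : RegularCost h (fun y x => c x y) Λ Ω) (hxm : xm ∈ Ω) (hy : y ∈ Λ)
    (hy_eq : A + θ • B = momentumAt g c xm y)
    (hx_eq : A' + s₀ • B' = momentumAt h (fun y x => c x y) y xm) :
    deriv (fun s => costAcceleration c (cLine g c Λ xm A B) θ
      (cLine h (fun y x => c x y) Ω y A' B' s)) s₀ = 0 := by
  rw [(H.eventually_costAcceleration_cLine H' hxm hy hy_eq hxm hx_eq).deriv_eq,
    deriv_comp_prodMk_left ((contDiffAt_jetDeriv_comp_cLine H.toSmoothCost H' hxm hy hx_eq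
      _ _).differentiableAt two_ne_zero)
      ((H'.contDiffAt_cLineChart hy hxm hx_eq).differentiableAt three_ne_zero),
    H'.cLineChart_eq hy hxm hx_eq, ← chartPt,
    ← jetDeriv_dirDeriv_comm ((H.contDiffAt hxm hy).of_le (by norm_num))]
  exact H.jetDeriv_acceleration hxm hy hy_eq _

theorem deriv_deriv_costAcceleration_cLine (H : RegularCost g c Ω Λ)
    (H' : RegularCost h (fun y x => c x y) Λ Ω) (hxm : xm ∈ Ω) (hy : y ∈ Λ)
    (hy_eq : A + θ • B = momentumAt g c xm y) (hx₀ : x₀ ∈ Ω)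
    (hx_eq : A' + s₀ • B' = momentumAt h (fun y x => c x y) y x₀) {ξ : Euc n}
    (hξ : ∀ u : Euc n, dirDeriv (0, deriv (cLineChart g c Λ xm A B y) θ)
      (dirDeriv (u, 0) (costInChart c x₀ y)) (chartPt n x₀ y) = -metricAt g x₀ ξ u) :
    deriv (deriv fun s => costAcceleration c (cLine g c Λ xm A B) θ
        (cLine h (fun y x => c x y) Ω y A' B' s)) s₀
      = -curvatureAt g c Λ x₀ y (deriv (cLineChart h (fun y x => c x y) Ω y A' B' x₀) s₀) ξ := by
  rw [(H.eventually_costAcceleration_cLine H' hxm hy hy_eq hx₀ hx_eq).deriv.deriv_eq,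
    deriv_deriv_comp_prodMk_left (contDiffAt_jetDeriv_comp_cLine H.toSmoothCost H' hx₀ hy hx_eq _ _)
      ((H'.contDiffAt_cLineChart hy hx₀ hx_eq).of_le (by norm_num)),
    H'.cLineChart_eq hy hx₀ hx_eq, ← chartPt]
  exact H.jetDeriv_jetDeriv_eq_neg_curvatureAt H' hx₀ hy hx_eq _ hξ

end

/-- Loeper's formula, from a second order mean value theorem along the `c^*`-segment between `x_m`
and `x`. -/
theorem exists_costAcceleration_eq (H : RegularCost g c Ω Λ)
    (H' : RegularCost h (fun y x => c x y) Λ Ω) (hxm : xm ∈ Ω) (hy : y ∈ Λ)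
    (hy_eq : A + θ • B = momentumAt g c xm y) (hB : B ≠ 0) (hx : x ∈ Ω) (hne : x ≠ xm)
    (hzero : costVelocity c (cLine g c Λ xm A B) θ x
      = costVelocity c (cLine g c Λ xm A B) θ xm) :
    ∃ x₀ ∈ Ω, ∃ η ξ : Euc n, η ≠ 0 ∧ ξ ≠ 0 ∧ metricAt g x₀ η ξ = 0 ∧
      costAcceleration c (cLine g c Λ xm A B) θ x
        = costAcceleration c (cLine g c Λ xm A B) θ xm - curvatureAt g c Λ x₀ y η ξ / 2 := by
  have : Nonempty M := ⟨xm⟩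
  set b := deriv (cLineChart g c Λ xm A B y) θ
  set A' := momentumAt h (fun y x => c x y) y xm
  set B' := momentumAt h (fun y x => c x y) y x - A'
  set X := cLine h (fun y x => c x y) Ω y A' B'
  have hX (s : ℝ) (hs : s ∈ Icc (0 : ℝ) 1) :
      X s ∈ Ω ∧ A' + s • B' = momentumAt h (fun y x => c x y) y (X s) :=
    H'.cLine_segment_mem hy hxm hx hs
  have hX₀ : X 0 = xm := H'.cLine_eq hy hxm (by simp [A'])
  have hX₁ : X 1 = x := H'.cLine_eq hy hx (by simp [B'])
  obtain ⟨s, hs, hmean⟩ := exists_second_order_mean_value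
    (fun s hs => H.contDiffAt_costAcceleration_cLine H' hxm hy hy_eq (hX s hs).1 (hX s hs).2)
    (H.deriv_costAcceleration_cLine_eq_zero H' hxm hy hy_eq (s₀ := 0) (by simp [A']))
  obtain ⟨hx₀, hx_eq⟩ := hX s (Ioo_subset_Icc_self hs)
  obtain ⟨ξ, hξ⟩ := H.exists_dual_velocity g hx₀ hy b
  have hB' : B' ≠ 0 := fun h₀ => hne (H'.injOn y hy hx hxm (sub_eq_zero.1 h₀))
  have hb : b ≠ 0 := H.velocity_ne_zero hxm hy hy_eq hB
  have hnull : metricAt h y B' b = 0 := by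
    rw [H.costVelocity_cLine h hxm hy hy_eq hx, H.costVelocity_cLine h hxm hy hy_eq hxm,
      neg_inj] at hzero
    simp only [B', map_sub, sub_apply, hzero, A', b, sub_self]
  refine ⟨X s, hx₀, deriv (cLineChart h (fun y x => c x y) Ω y A' B' (X s)) s, ξ,
    H'.velocity_ne_zero hy hx₀ hx_eq hB', ?_, ?_, ?_⟩
  · rintro rfl
    exact hb (H.eq_zero_of_dirDeriv hx₀ hy fun u => by simpa using hξ u)
  · have hvel := H'.dirDeriv_velocity_swap hx₀ hy hx_eq b
    rw [hnull, dirDeriv_comm ((H.contDiffAt hx₀ hy).of_le (by norm_num)), hξ, neg_inj] at hvel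
    rw [metricAt_comm, hvel]
  · rw [H.deriv_deriv_costAcceleration_cLine H' hxm hy hy_eq hx₀ hx_eq hξ] at hmean
    change costAcceleration c _ θ (X 1) = costAcceleration c _ θ (X 0) + _ at hmean
    rw [hX₀, hX₁] at hmean
    rw [hmean]
    ring

end RegularCost

end CrossCurvature

section PositiveCurvature

variable {n : ℕ} {M : Type*} [TopologicalSpace M] [ChartedSpace (Euc n) M]
  [IsManifold (𝓡 n) ∞ M] {N : Type*} [Nonempty N] {g : RMetric n M} {c : M → N → ℝ} {Ω : Set M}
  {Λ : Set N}

/-- The pointwise form of (A3S): the `c`-sectional curvature is positive on pairs of nonzero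
orthogonal vectors, without a uniform lower bound. -/
def PositiveCurvature (g : RMetric n M) (c : M → N → ℝ) (Ω : Set M) (Λ : Set N) : Prop :=
  ∀ x ∈ Ω, ∀ y ∈ Λ, ∀ η ξ : TangentSpace (𝓡 n) x, η ≠ 0 → ξ ≠ 0 → g.inner x η ξ = 0 →
    0 < cSectionalCurvature g c Λ x y η ξ

theorem CurvatureBound.zero {C₀ : ℝ} (h : CurvatureBound g c Ω Λ C₀) (hC₀ : 0 ≤ C₀) :
    CurvatureBound g c Ω Λ 0 := fun x hx y hy η ξ horth => by
  rw [zero_mul, zero_mul]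
  exact (mul_nonneg (mul_nonneg hC₀ (metricAt_self_nonneg g x η))
    (metricAt_self_nonneg g x ξ)).trans (h x hx y hy η ξ horth)

theorem CurvatureBound.positiveCurvature {C₀ : ℝ} (h : CurvatureBound g c Ω Λ C₀)
    (hC₀ : 0 < C₀) : PositiveCurvature g c Ω Λ := fun x hx y hy η ξ hη hξ horth =>
  (mul_pos (mul_pos hC₀ (g.pos x η hη)) (g.pos x ξ hξ)).trans_le (h x hx y hy η ξ horth)

theorem hessAt_zero (g : RMetric n M) (f : M → ℝ) (x : M) : hessAt g f x 0 0 = 0 := by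
  have hΓ : christoffelAt g x 0 0 = 0 := by
    simp only [christoffelAt, christoffel, map_zero, add_zero, sub_zero, smul_zero]
    exact map_zero (sharpAt g x)
  change fderiv ℝ (fderiv ℝ (f ∘ (extChartAt (𝓡 n) x).symm)) (extChartAt (𝓡 n) x x) 0 0
    - differentialAt n f x (christoffelAt g x 0 0) = 0
  rw [hΓ, map_zero, map_zero, sub_zero]

theorem curvatureAt_zero_left (g : RMetric n M) (c : M → N → ℝ) (Λ : Set N) (x : M) (y : N)
    (ξ : Euc n) : curvatureAt g c Λ x y 0 ξ = 0 := by
  change iteratedDeriv 2 (fun t : ℝ => -hessAt g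
    (fun x' => c x' (cExpAt g c Λ x (momentumAt g c x y + t • ξ))) x 0 0) 0 = 0
  simp only [hessAt_zero, neg_zero, iteratedDeriv_const, two_ne_zero, if_false]

theorem curvatureAt_zero_right (g : RMetric n M) (c : M → N → ℝ) (Λ : Set N) (x : M) (y : N)
    (η : Euc n) : curvatureAt g c Λ x y η 0 = 0 := by
  change iteratedDeriv 2 (fun t : ℝ => -hessAt g
    (fun x' => c x' (cExpAt g c Λ x (momentumAt g c x y + t • 0))) x η η) 0 = 0
  simp only [smul_zero, iteratedDeriv_const, two_ne_zero, if_false]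

theorem PositiveCurvature.curvatureBound_zero (h : PositiveCurvature g c Ω Λ) :
    CurvatureBound g c Ω Λ 0 := fun x hx y hy η ξ horth => by
  rw [zero_mul, zero_mul]
  rcases eq_or_ne η 0 with rfl | hη
  · exact (curvatureAt_zero_left g c Λ x y ξ).ge
  rcases eq_or_ne ξ 0 with rfl | hξ
  · exact (curvatureAt_zero_right g c Λ x y η).ge
  exact (h x hx y hy η ξ hη hξ horth).le

end PositiveCurvature

section Mountain

variable {n : ℕ} {M : Type*} [TopologicalSpace M] [ChartedSpace (Euc n) M]
  [IsManifold (𝓡 n) ∞ M] {N : Type*} [Nonempty N]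

/-- The sliding mountain at `x` along the `c`-segment `t ↦ c-Exp_{x_m}(A + tB)`, as a function
of `t`. -/
def mountain (g : RMetric n M) (c : M → N → ℝ) (Λ : Set N) (xm : M) (A B : Euc n) (x : M)
    (t : ℝ) : ℝ :=
  -c x (cLine g c Λ xm A B t) + c xm (cLine g c Λ xm A B t)

/-- `mountain`, with the point in the preferred chart at `x`. -/
def mountainChart (g : RMetric n M) (c : M → N → ℝ) (Λ : Set N) (xm : M) (A B : Euc n) (x : M)
    (p : ℝ × Euc n) : ℝ :=
  mountain g c Λ xm A B ((extChartAt (𝓡 n) x).symm p.2) p.1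

theorem mountain_self (g : RMetric n M) (c : M → N → ℝ) (Λ : Set N) (xm : M) (A B : Euc n) :
    mountain g c Λ xm A B xm = fun _ => 0 :=
  funext fun _ => neg_add_cancel _

variable [TopologicalSpace N] [ChartedSpace (Euc n) N]

namespace RegularCost

variable {g : RMetric n M} {c : M → N → ℝ} {Ω : Set M} {Λ : Set N} {xm x : M} {y : N}
  {A B : Euc n} {θ : ℝ}

theorem contDiffAt_cost_cLine_chart (H : RegularCost g c Ω Λ) (hxm : xm ∈ Ω) (hy : y ∈ Λ)
    (hy_eq : A + θ • B = momentumAt g c xm y) (hx : x ∈ Ω) :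
    ContDiffAt ℝ 3 (fun p : ℝ × Euc n => c ((extChartAt (𝓡 n) x).symm p.2)
      (cLine g c Λ xm A B p.1)) (θ, extChartAt (𝓡 n) x x) := by
  have hc := H.contDiffAt hx hy
  rw [chartPt, ← H.cLineChart_eq hxm hy hy_eq] at hc
  have hγ : ContDiffAt ℝ 3 (fun p : ℝ × Euc n => cLineChart g c Λ xm A B y p.1)
      (θ, extChartAt (𝓡 n) x x) :=
    ContDiffAt.comp (f := Prod.fst) (θ, extChartAt (𝓡 n) x x)
      (H.contDiffAt_cLineChart hxm hy hy_eq) contDiffAt_fst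
  refine ContDiffAt.congr_of_eventuallyEq (ContDiffAt.comp (g := costInChart c x y)
    (θ, extChartAt (𝓡 n) x x) (hc.of_le (by norm_num)) (contDiffAt_snd.prodMk hγ)) ?_
  filter_upwards [continuousAt_fst.eventually (H.eventually_cLine_mem hxm hy hy_eq)] with p hp
  simp only [Function.comp_apply, costInChart, hp.2]

theorem contDiffAt_cost_cLine (H : RegularCost g c Ω Λ) (hxm : xm ∈ Ω) (hy : y ∈ Λ)
    (hy_eq : A + θ • B = momentumAt g c xm y) (hx : x ∈ Ω) :
    ContDiffAt ℝ 3 (fun t => c x (cLine g c Λ xm A B t)) θ := by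
  have h := ContDiffAt.comp (f := fun t : ℝ => (t, extChartAt (𝓡 n) x x)) θ
    (H.contDiffAt_cost_cLine_chart hxm hy hy_eq hx) (by fun_prop)
  simpa only [Function.comp_def, extChartAt_to_inv] using h

theorem contDiffAt_mountainChart (H : RegularCost g c Ω Λ) (hxm : xm ∈ Ω) (hy : y ∈ Λ)
    (hy_eq : A + θ • B = momentumAt g c xm y) (hx : x ∈ Ω) :
    ContDiffAt ℝ 3 (mountainChart g c Λ xm A B x) (θ, extChartAt (𝓡 n) x x) :=
  (H.contDiffAt_cost_cLine_chart hxm hy hy_eq hx).neg.add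
    (ContDiffAt.comp (f := Prod.fst) _ (H.contDiffAt_cost_cLine hxm hy hy_eq hxm) contDiffAt_fst)

theorem contDiffAt_mountain (H : RegularCost g c Ω Λ) (hxm : xm ∈ Ω) (hy : y ∈ Λ)
    (hy_eq : A + θ • B = momentumAt g c xm y) (hx : x ∈ Ω) :
    ContDiffAt ℝ 3 (mountain g c Λ xm A B x) θ :=
  (H.contDiffAt_cost_cLine hxm hy hy_eq hx).neg.add (H.contDiffAt_cost_cLine hxm hy hy_eq hxm)

theorem eventually_deriv_mountain (H : RegularCost g c Ω Λ) (hxm : xm ∈ Ω) (hy : y ∈ Λ)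
    (hy_eq : A + θ • B = momentumAt g c xm y) (hx : x ∈ Ω) :
    deriv (mountain g c Λ xm A B x) =ᶠ[𝓝 θ] fun t =>
      -costVelocity c (cLine g c Λ xm A B) t x + costVelocity c (cLine g c Λ xm A B) t xm := by
  filter_upwards [(H.contDiffAt_cost_cLine hxm hy hy_eq hx).eventually (by simp),
    (H.contDiffAt_cost_cLine hxm hy hy_eq hxm).eventually (by simp)] with t hx hxm
  rw [costVelocity, costVelocity, ← deriv.fun_neg]
  exact deriv_fun_add (hx.differentiableAt three_ne_zero).fun_neg
    (hxm.differentiableAt three_ne_zero)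

theorem deriv_mountain (H : RegularCost g c Ω Λ) (hxm : xm ∈ Ω) (hy : y ∈ Λ)
    (hy_eq : A + θ • B = momentumAt g c xm y) (hx : x ∈ Ω) :
    deriv (mountain g c Λ xm A B x) θ
      = -costVelocity c (cLine g c Λ xm A B) θ x + costVelocity c (cLine g c Λ xm A B) θ xm :=
  (H.eventually_deriv_mountain hxm hy hy_eq hx).eq_of_nhds

theorem deriv_deriv_mountain (H : RegularCost g c Ω Λ) (hxm : xm ∈ Ω) (hy : y ∈ Λ)
    (hy_eq : A + θ • B = momentumAt g c xm y) (hx : x ∈ Ω) :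
    deriv (deriv (mountain g c Λ xm A B x)) θ
      = -costAcceleration c (cLine g c Λ xm A B) θ x
        + costAcceleration c (cLine g c Λ xm A B) θ xm := by
  have hdiff {x : M} (hx : x ∈ Ω) :
      DifferentiableAt ℝ (deriv fun t => c x (cLine g c Λ xm A B t)) θ :=
    differentiableAt_deriv ((H.contDiffAt_cost_cLine hxm hy hy_eq hx).of_le (by norm_num))
  rw [(H.eventually_deriv_mountain hxm hy hy_eq hx).deriv_eq, costAcceleration, costAcceleration,
    ← deriv.fun_neg]
  exact deriv_fun_add (hdiff hx).fun_neg (hdiff hxm)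

theorem dirDeriv_dirDeriv_mountainChart (H : RegularCost g c Ω Λ) (hxm : xm ∈ Ω) (hy : y ∈ Λ)
    (hy_eq : A + θ • B = momentumAt g c xm y) (hx : x ∈ Ω) (u : Euc n) :
    dirDeriv (0, u) (dirDeriv (1, 0) (mountainChart g c Λ xm A B x))
        (θ, extChartAt (𝓡 n) x x)
      = -dirDeriv (0, deriv (cLineChart g c Λ xm A B y) θ) (dirDeriv (u, 0) (costInChart c x y))
          (chartPt n x y) := by
  have hc : ContDiffAt ℝ 2 (costInChart c x y) (chartPt n x y) :=
    (H.contDiffAt hx hy).of_le (by norm_num)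
  have hF := (H.contDiffAt_mountainChart hxm hy hy_eq hx).of_le (m := 2) (by norm_num)
  have hmk : ContinuousAt (fun z : Euc n => (θ, z)) (extChartAt (𝓡 n) x x) := by fun_prop
  have hvel : (fun z => dirDeriv (1, 0) (mountainChart g c Λ xm A B x) (θ, z))
      =ᶠ[𝓝 (extChartAt (𝓡 n) x x)] fun z =>
        -dirDeriv (0, deriv (cLineChart g c Λ xm A B y) θ) (costInChart c x y)
          (z, extChartAt (𝓡 n) y y) + costVelocity c (cLine g c Λ xm A B) θ xm := by
    filter_upwards [hmk.eventually (hF.eventually (by simp)),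
      eventually_chart_symm_mem H.isOpen_left hx,
      H.eventually_costVelocity hxm hy hy_eq hx] with z hFz hz hvelz
    rw [dirDeriv_one_zero (hFz.differentiableAt two_ne_zero), ← hvelz]
    exact H.deriv_mountain hxm hy hy_eq hz
  have hcomp := dirDeriv_comp (hasFDerivAt_prodMk_right θ _) (differentiableAt_dirDeriv hF (1, 0)) u
  rw [ContinuousLinearMap.inr_apply] at hcomp
  rw [← hcomp, (dirDeriv_congr hvel u).eq_of_nhds, dirDeriv_comm hc, dirDeriv, fderiv_add_const,
    fderiv_fun_neg, neg_apply]
  have hright := dirDeriv_comp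
    (hasFDerivAt_prodMk_left (𝕜 := ℝ) (extChartAt (𝓡 n) x x) (extChartAt (𝓡 n) y y))
    (differentiableAt_dirDeriv hc (0, deriv (cLineChart g c Λ xm A B y) θ)) u
  rw [ContinuousLinearMap.inl_apply] at hright
  exact congrArg Neg.neg hright

theorem exists_dirDeriv_dirDeriv_mountainChart_pos (H : RegularCost g c Ω Λ) (hxm : xm ∈ Ω)
    (hy : y ∈ Λ) (hy_eq : A + θ • B = momentumAt g c xm y) (hB : B ≠ 0) (hx : x ∈ Ω) :
    ∃ u : Euc n, 0 < dirDeriv (0, u) (dirDeriv (1, 0) (mountainChart g c Λ xm A B x))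
      (θ, extChartAt (𝓡 n) x x) := by
  by_contra! hcon
  refine H.velocity_ne_zero hxm hy hy_eq hB (H.eq_zero_of_dirDeriv hx hy fun u => ?_)
  rw [← neg_eq_zero, ← H.dirDeriv_dirDeriv_mountainChart hxm hy hy_eq hx]
  refine (hcon u).antisymm ?_
  have hneg : ((0 : ℝ), u) = -(0, -u) := by simp
  rw [hneg, dirDeriv, map_neg]
  exact neg_nonneg.2 (hcon (-u))

variable [IsManifold (𝓡 n) ∞ N] {h : RMetric n N}

theorem exists_deriv_deriv_mountain_eq (H : RegularCost g c Ω Λ)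
    (H' : RegularCost h (fun y x => c x y) Λ Ω) (hxm : xm ∈ Ω) (hy : y ∈ Λ)
    (hy_eq : A + θ • B = momentumAt g c xm y) (hB : B ≠ 0) (hx : x ∈ Ω) (hne : x ≠ xm)
    (hzero : deriv (mountain g c Λ xm A B x) θ = 0) :
    ∃ x₀ ∈ Ω, ∃ η ξ : Euc n, η ≠ 0 ∧ ξ ≠ 0 ∧ metricAt g x₀ η ξ = 0 ∧
      deriv (deriv (mountain g c Λ xm A B x)) θ = curvatureAt g c Λ x₀ y η ξ / 2 := by
  rw [H.deriv_mountain hxm hy hy_eq hx, neg_add_eq_zero] at hzero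
  obtain ⟨x₀, hx₀, η, ξ, hη, hξ, horth, hacc⟩ :=
    H.exists_costAcceleration_eq H' hxm hy hy_eq hB hx hne hzero
  refine ⟨x₀, hx₀, η, ξ, hη, hξ, horth, ?_⟩
  rw [H.deriv_deriv_mountain hxm hy hy_eq hx, hacc]
  ring

theorem deriv_deriv_mountain_nonneg (H : RegularCost g c Ω Λ)
    (H' : RegularCost h (fun y x => c x y) Λ Ω) (hcurv : CurvatureBound g c Ω Λ 0) (hxm : xm ∈ Ω)
    (hy : y ∈ Λ) (hy_eq : A + θ • B = momentumAt g c xm y) (hB : B ≠ 0) (hx : x ∈ Ω)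
    (hzero : deriv (mountain g c Λ xm A B x) θ = 0) :
    0 ≤ deriv (deriv (mountain g c Λ xm A B x)) θ := by
  rcases eq_or_ne x xm with rfl | hne
  · simp [mountain_self]
  · obtain ⟨x₀, hx₀, η, ξ, -, -, horth, heq⟩ :=
      H.exists_deriv_deriv_mountain_eq H' hxm hy hy_eq hB hx hne hzero
    have h := hcurv x₀ hx₀ y hy η ξ horth
    rw [zero_mul, zero_mul] at h
    exact heq ▸ div_nonneg h zero_le_two

theorem eventually_deriv_mountain_nonneg (H : RegularCost g c Ω Λ)
    (H' : RegularCost h (fun y x => c x y) Λ Ω) (hcurv : CurvatureBound g c Ω Λ 0) (hxm : xm ∈ Ω)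
    (hy : y ∈ Λ) (hy_eq : A + θ • B = momentumAt g c xm y) (hB : B ≠ 0) (hx : x ∈ Ω)
    (hzero : deriv (mountain g c Λ xm A B x) θ = 0) :
    ∀ᶠ t in 𝓝[>] θ, 0 ≤ deriv (mountain g c Λ xm A B x) t := by
  obtain ⟨u, hu⟩ := H.exists_dirDeriv_dirDeriv_mountainChart_pos hxm hy hy_eq hB hx
  have hslice : (fun t => mountainChart g c Λ xm A B x (t, extChartAt (𝓡 n) x x))
      = mountain g c Λ xm A B x := by
    simp only [mountainChart, extChartAt_to_inv]
  rw [← hslice] at hzero ⊢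
  refine eventually_deriv_nonneg_of_dirDeriv_pos
    ((H.contDiffAt_mountainChart hxm hy hy_eq hx).of_le (by norm_num)) hzero hu ?_
  filter_upwards [continuousAt_fst.eventually (H.eventually_cLine_mem hxm hy hy_eq),
    continuousAt_snd.eventually (eventually_chart_symm_mem H.isOpen_left hx)] with p hp hpΩ
  exact H.deriv_deriv_mountain_nonneg H' hcurv hxm (cExpAt_mem hp.1)
    (momentumAt_cExpAt hp.1).symm hB hpΩ

theorem deriv_mountain_nonneg (H : RegularCost g c Ω Λ)
    (H' : RegularCost h (fun y x => c x y) Λ Ω) (hcurv : CurvatureBound g c Ω Λ 0) (hxm : xm ∈ Ω)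
    {θ₁ θ₂ : ℝ} (hdom : ∀ t ∈ Icc θ₁ θ₂, A + t • B ∈ momentumAt g c xm '' Λ) (hx : x ∈ Ω)
    (hnonneg : 0 ≤ deriv (mountain g c Λ xm A B x) θ₁) :
    ∀ t ∈ Icc θ₁ θ₂, 0 ≤ deriv (mountain g c Λ xm A B x) t := by
  rcases eq_or_ne B 0 with rfl | hB
  · have hconst : mountain g c Λ xm A 0 x = fun _ => mountain g c Λ xm A 0 x 0 := by
      funext t
      simp only [mountain, cLine, smul_zero]
    intro t _
    rw [hconst, deriv_const]
  · refine nonneg_of_right_of_zeros (fun t ht => ?_) hnonneg fun t ht hzero => ?_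
    · exact (differentiableAt_deriv ((H.contDiffAt_mountain hxm (cExpAt_mem (hdom t ht))
        (momentumAt_cExpAt (hdom t ht)).symm hx).of_le
          (by norm_num))).continuousAt.continuousWithinAt
    · have hmem := hdom t (Ico_subset_Icc_self ht)
      exact H.eventually_deriv_mountain_nonneg H' hcurv hxm (cExpAt_mem hmem)
        (momentumAt_cExpAt hmem).symm hB hx hzero

theorem eq_of_deriv_mountain_eq_zero (H : RegularCost g c Ω Λ)
    (H' : RegularCost h (fun y x => c x y) Λ Ω) (hcurv : PositiveCurvature g c Ω Λ) (hxm : xm ∈ Ω)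
    {θ₁ θ₂ : ℝ} (hθ : θ₁ < θ₂) (hdom : ∀ t ∈ Icc θ₁ θ₂, A + t • B ∈ momentumAt g c xm '' Λ)
    (hB : B ≠ 0) (hx : x ∈ Ω) (h₁ : deriv (mountain g c Λ xm A B x) θ₁ = 0)
    (h₂ : deriv (mountain g c Λ xm A B x) θ₂ = 0) : x = xm := by
  by_contra hne
  have hmem := hdom θ₂ (right_mem_Icc.2 hθ.le)
  obtain ⟨x₀, hx₀, η, ξ, hη, hξ, horth, heq⟩ := H.exists_deriv_deriv_mountain_eq H' hxm
    (cExpAt_mem hmem) (momentumAt_cExpAt hmem).symm hB hx hne h₂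
  have hpos : 0 < deriv (deriv (mountain g c Λ xm A B x)) θ₂ :=
    heq ▸ half_pos (hcurv x₀ hx₀ _ (cExpAt_mem hmem) η ξ hη hξ horth)
  have hneg : ∀ᶠ t in 𝓝[<] θ₂, deriv (mountain g c Λ xm A B x) t < 0 := by
    filter_upwards [(eventually_nhdsWithin_sign_eq_of_deriv_pos hpos h₂).filter_mono
      nhdsWithin_le_nhds, self_mem_nhdsWithin] with t hsign ht
    rwa [sign_neg (sub_neg.2 ht), sign_eq_neg_one_iff] at hsign
  obtain ⟨t, hlt, ht⟩ := (hneg.and (Ioo_mem_nhdsLT hθ)).exists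
  exact hlt.not_ge
    (H.deriv_mountain_nonneg H' hcurv.curvatureBound_zero hxm hdom hx h₁.ge t ⟨ht.1.le, ht.2.le⟩)

end RegularCost

end Mountain

section Monotonicity

variable {n : ℕ} {M : Type*} [TopologicalSpace M] [ChartedSpace (Euc n) M]
  [IsManifold (𝓡 n) ∞ M] {N : Type*} [Nonempty N]

theorem slidingMountain_eq_mountain (g : RMetric n M) (c : M → N → ℝ) (Λ : Set N) (xm : M)
    (y₀ y₁ : N) (x : M) : (fun s => slidingMountain g c Λ xm y₀ y₁ s x)
      = mountain g c Λ xm (momentumAt g c xm y₀) (momentumAt g c xm y₁ - momentumAt g c xm y₀)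
          x := by
  funext s
  have hsegment : cSegment g c Λ xm y₀ y₁ s = cLine g c Λ xm (momentumAt g c xm y₀)
      (momentumAt g c xm y₁ - momentumAt g c xm y₀) s := by
    change cExpAt g c Λ xm ((1 - s) • momentumAt g c xm y₀ + s • momentumAt g c xm y₁) = _
    rw [cLine]
    congr 1
    module
  rw [slidingMountain, hsegment, mountain]

theorem mem_levelSet_self (g : RMetric n M) (c : M → N → ℝ) {Ω : Set M} (Λ : Set N) {xm : M}
    (hxm : xm ∈ Ω) (y₀ y₁ : N) (θ : ℝ) : xm ∈ levelSet g c Ω Λ xm y₀ y₁ θ :=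
  ⟨hxm, by rw [slidingMountain_eq_mountain, mountain_self, deriv_const]⟩

variable [TopologicalSpace N] [ChartedSpace (Euc n) N] [IsManifold (𝓡 n) ∞ N]

namespace RegularCost

variable {g : RMetric n M} {h : RMetric n N} {c : M → N → ℝ} {Ω : Set M} {Λ : Set N} {xm : M}
  {y₀ y₁ : N}

theorem monotonicity (H : RegularCost g c Ω Λ) (H' : RegularCost h (fun y x => c x y) Λ Ω)
    (hcurv : CurvatureBound g c Ω Λ 0) (hxm : xm ∈ Ω) (hy₀ : y₀ ∈ Λ) (hy₁ : y₁ ∈ Λ) :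
    Monotonicity g c Ω Λ xm y₀ y₁ := by
  rintro θ₁ θ₂ hθ₁ hθ hθ₂ x ⟨hx, hnonneg⟩
  rw [slidingMountain_eq_mountain] at hnonneg
  refine ⟨hx, ?_⟩
  rw [slidingMountain_eq_mountain]
  exact H.deriv_mountain_nonneg H' hcurv hxm
    (fun t ht => H.add_smul_sub_mem hxm hy₀ hy₁ ⟨hθ₁.trans ht.1, ht.2.trans hθ₂⟩) hx hnonneg θ₂
    (right_mem_Icc.2 hθ)

theorem strictMonotonicity (H : RegularCost g c Ω Λ) (H' : RegularCost h (fun y x => c x y) Λ Ω)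
    (hcurv : PositiveCurvature g c Ω Λ) (hxm : xm ∈ Ω) (hy₀ : y₀ ∈ Λ) (hy₁ : y₁ ∈ Λ)
    (hne : y₀ ≠ y₁) : StrictMonotonicity g c Ω Λ xm y₀ y₁ := by
  refine ⟨H.monotonicity H' hcurv.curvatureBound_zero hxm hy₀ hy₁, fun θ₁ θ₂ hθ₁ hθ hθ₂ => ?_⟩
  refine Subset.antisymm ?_ (singleton_subset_iff.2
    ⟨mem_levelSet_self g c Λ hxm y₀ y₁ θ₁, mem_levelSet_self g c Λ hxm y₀ y₁ θ₂⟩)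
  rintro x ⟨⟨hx, hzero₁⟩, -, hzero₂⟩
  rw [slidingMountain_eq_mountain] at hzero₁ hzero₂
  have hB : momentumAt g c xm y₁ - momentumAt g c xm y₀ ≠ 0 :=
    sub_ne_zero.2 fun heq => hne (H.injOn xm hxm hy₁ hy₀ heq).symm
  exact H.eq_of_deriv_mountain_eq_zero H' hcurv hxm hθ
    (fun t ht => H.add_smul_sub_mem hxm hy₀ hy₁ ⟨hθ₁.trans ht.1, ht.2.trans hθ₂⟩) hB hx
    hzero₁ hzero₂

end RegularCost

end Monotonicity

end

end CostTransport

open CostTransport in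
theorem theorem5p3_general {n : ℕ}
    {M : Type*} [TopologicalSpace M] [ChartedSpace (Euc n) M] [IsManifold (𝓡 n) ∞ M]
    {N : Type*} [TopologicalSpace N] [ChartedSpace (Euc n) N] [IsManifold (𝓡 n) ∞ N] [Nonempty N]
    (g : RMetric n M) (h : RMetric n N) {Ω : Set M} {Λ : Set N} {c : M → N → ℝ}
    (hc : SmoothCost n c Ω Λ)
    (hdet : ∀ x ∈ Ω, ∀ y ∈ Λ, (mixedHess n c x y (x, y)).det ≠ 0)
    (hinj : ∀ x ∈ Ω, InjOn (momentum g c x) Λ)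
    (hinj' : ∀ y ∈ Λ, InjOn (momentum h (fun y x => c x y) y) Ω)
    (hΛconv : CConvex g c Ω Λ) (hΩconv : CConvex h (fun y x => c x y) Λ Ω) :
    (CurvatureBound g c Ω Λ 0 →
      ∀ xm ∈ Ω, ∀ y₀ ∈ Λ, ∀ y₁ ∈ Λ, Monotonicity g c Ω Λ xm y₀ y₁) ∧
    (PositiveCurvature g c Ω Λ →
      ∀ xm ∈ Ω, ∀ y₀ ∈ Λ, ∀ y₁ ∈ Λ, y₀ ≠ y₁ → StrictMonotonicity g c Ω Λ xm y₀ y₁) := by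
  have H : RegularCost g c Ω Λ := ⟨hc, hdet, hinj, hΛconv⟩
  have H' : RegularCost h (fun y x => c x y) Λ Ω :=
    ⟨hc.swap, fun y hy x hx => by
      rw [hc.mixedHess_swap hx hy, Matrix.det_transpose]
      exact hdet x hx y hy, hinj', hΩconv⟩
  exact ⟨fun hcurv _ hxm _ hy₀ _ hy₁ => H.monotonicity H' hcurv hxm hy₀ hy₁,
    fun hcurv _ hxm _ hy₀ _ hy₁ hne => H.strictMonotonicity H' hcurv hxm hy₀ hy₁ hne⟩

theorem theorem5p3 {n : ℕ}
    {M : Type*} [TopologicalSpace M] [T2Space M] [ChartedSpace (CostTransport.Euc n) M]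
    [IsManifold (𝓡 n) ∞ M]
    {N : Type*} [TopologicalSpace N] [T2Space N] [ChartedSpace (CostTransport.Euc n) N]
    [IsManifold (𝓡 n) ∞ N] [Nonempty N]
    (g : CostTransport.RMetric n M) (h : CostTransport.RMetric n N)
    (Ω : Set M) (hΩo : IsOpen Ω) (hΩc : IsConnected Ω)
    (Λ : Set N) (hΛo : IsOpen Λ) (hΛc : IsConnected Λ)
    (c : M → N → ℝ)
    (hA0 : CostTransport.A0 n c Ω Λ)
    (hA1 : CostTransport.A1 g h c Ω Λ)
    (hA2 : CostTransport.A2 n c Ω Λ)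
    (hΛconv : CostTransport.CConvex g c Ω Λ)
    (hΩconv : CostTransport.CConvex h (fun y x => c x y) Λ Ω) :
    (CostTransport.A3W g c Ω Λ →
      ∀ xm ∈ Ω, ∀ y₀ ∈ Λ, ∀ y₁ ∈ Λ, CostTransport.Monotonicity g c Ω Λ xm y₀ y₁) ∧
    (CostTransport.A3S g c Ω Λ →
      ∀ xm ∈ Ω, ∀ y₀ ∈ Λ, ∀ y₁ ∈ Λ, y₀ ≠ y₁ →
        CostTransport.StrictMonotonicity g c Ω Λ xm y₀ y₁) := by
  have hc := hA0.smoothCost hΩo hΛo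
  obtain ⟨hweak, hstrict⟩ := theorem5p3_general g h hc
    (fun _ hx _ hy => hc.det_mixedHess_ne_zero hA2 hx hy)
    (fun _ hx => hc.injOn_momentumAt hA1.1 hx) (fun _ hy => hc.swap.injOn_momentumAt hA1.2 hy)
    hΛconv hΩconv
  exact ⟨fun ⟨_, hC₀, hcurv⟩ => hweak (hcurv.zero hC₀),
    fun ⟨_, hC₀, hcurv⟩ => hstrict (hcurv.positiveCurvature hC₀)⟩
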